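/- Let $\mathbb T^2=(\mathbb R/2\pi\mathbb Z)^2$ and let $U=U(t,y)$ be a real-valued measurable function on $(0,\infty)\times\mathbb R/2\pi\mathbb Z$ with $\|U\|_{L^\infty_tL^2_y}<\infty$. Let $\rho\in C([0,\infty);L^2(\mathbb T^2))\cap L^2_{\mathrm{loc}}([0,\infty);H^1(\mathbb T^2))$ be a real-valued distributional solution of $$\partial_t\rho+U(t,y)\,\partial_x\rho=\Delta\rho \quad\text{on } [0,\infty)\times\mathbb T^2$$ with initial value $\rho(0,\cdot)\in L^2(\mathbb T^2)$; that is, for all $\varphi\in C_c^\infty([0,\infty)\times\mathbb T^2)$, $$\int_0^\infty\!\!\int_{\mathbb T^2}\rho\,(\partial_t\varphi+U\,\partial_x\varphi+\Delta\varphi)\,dx\,dy\,dt+\int_{\mathbb T^2}\rho(0,\cdot)\,\varphi(0,\cdot)\,dx\,dy=0 .$$ Assume that $\rho(0,\cdot)$ has mean zero and is not almost everywhere equal to $0$, and that $\rho$ is smooth, in the sense that $\rho(t,\cdot)\in C^\infty(\mathbb T^2)$ for every $t>0$. Then $\|\rho(t)\|_{L^2}\neq 0$ for every $t\ge 0$,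 and $$\limsup_{t\to\infty}\frac{\|\rho(t)\|_{H^{-1}}}{\|\rho(t)\|_{L^2}}>0,$$ where $\|f\|_{H^{s}}^2=(2\pi)^2\sum_{(k,l)\in\mathbb Z^2}(1+k^2+l^2)^{s}\,|\hat f(k,l)|^2$ and $\hat f(k,l)=(2\pi)^{-2}\int_{\mathbb T^2}f(x,y)\,e^{-i(kx+ly)}\,dx\,dy$. -/

import Mathlib

open MeasureTheory Set Filter Topology
open scoped ENNReal NNReal ContDiff

noncomputable section

namespace TorusShear

/-- One period of the circle `ℝ / 2πℤ`. -/
def circleCell : Set ℝ := Ioc (-Real.pi) Real.pi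

/-- One period cell of the torus `𝕋² = (ℝ / 2πℤ)²`. -/
def torusCell : Set (ℝ × ℝ) := circleCell ×ˢ circleCell

/-- Functions on `𝕋²`, viewed as functions of `(x, y)` on the plane that are `2π`-periodic in each
variable. -/
def TorusPeriodic (f : ℝ × ℝ → ℝ) : Prop :=
  (∀ x y, f (x + 2 * Real.pi, y) = f (x, y)) ∧ (∀ x y, f (x, y + 2 * Real.pi) = f (x, y))

/-- The norm of `L²(𝕋²)`. -/
def normL2 (f : ℝ × ℝ → ℝ) : ℝ≥0∞ := eLpNorm f 2 (volume.restrict torusCell)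

/-- The Fourier coefficient `(2π)⁻² ∫_{𝕋²} f(x, y) e^{-i(kx + ly)} dx dy`, where `n = (k, l)`. -/
def torusFourierCoeff (f : ℝ × ℝ → ℝ) (n : ℤ × ℤ) : ℂ :=
  (1 / (2 * Real.pi) ^ 2 : ℂ) *
    ∫ p in torusCell, (f p : ℂ) * Complex.exp (-Complex.I * (n.1 * p.1 + n.2 * p.2))

/-- The norm of the Sobolev space `H^s(𝕋²)`,
`((2π)² ∑_{(k, l)} (1 + k² + l²)^s |f̂(k, l)|²)^{1/2}`, with the value `∞` if the sum diverges.
For `s = 0` it is the `L²` norm. -/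
def sobolevNorm (s : ℝ) (f : ℝ × ℝ → ℝ) : ℝ≥0∞ :=
  (∑' n : ℤ × ℤ, ENNReal.ofReal
    ((2 * Real.pi) ^ 2 * (1 + (n.1 : ℝ) ^ 2 + (n.2 : ℝ) ^ 2) ^ s
      * ‖torusFourierCoeff f n‖ ^ 2)) ^ (1 / 2 : ℝ)

/-- A shear profile `U(t, y)`, `t > 0`, `y ∈ ℝ / 2πℤ`, in `L^∞_t L²_y`. -/
structure IsShearProfile (U : ℝ → ℝ → ℝ) : Prop where
  periodic : ∀ t > 0, Function.Periodic (U t) (2 * Real.pi)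
  aestronglyMeasurable :
    AEStronglyMeasurable (fun q : ℝ × ℝ => U q.1 q.2) (volume.restrict (Ioi 0 ×ˢ circleCell))
  essSup_lt_top :
    essSup (fun t => eLpNorm (U t) 2 (volume.restrict circleCell)) (volume.restrict (Ioi (0 : ℝ)))
      < ⊤

/-- Test functions `φ(t, (x, y))` in `C_c^∞([0, ∞) × 𝕋²)`. -/
structure IsTestFunction (φ : ℝ → ℝ × ℝ → ℝ) : Prop where
  smooth : ContDiff ℝ ∞ (fun q : ℝ × (ℝ × ℝ) => φ q.1 q.2)
  periodic : ∀ t, TorusPeriodic (φ t)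
  eventually_zero : ∃ T : ℝ, ∀ t ≥ T, ∀ p, φ t p = 0

/-- `∂_t φ (t, x, y)` -/
def dt (φ : ℝ → ℝ × ℝ → ℝ) (t : ℝ) (p : ℝ × ℝ) : ℝ := deriv (fun s => φ s p) t

/-- `∂_x f (x, y)` -/
def dx (f : ℝ × ℝ → ℝ) (p : ℝ × ℝ) : ℝ := deriv (fun x => f (x, p.2)) p.1

/-- `∂_y f (x, y)` -/
def dy (f : ℝ × ℝ → ℝ) (p : ℝ × ℝ) : ℝ := deriv (fun y => f (p.1, y)) p.2

/-- `Δ f = ∂_x ∂_x f + ∂_y ∂_y f` -/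
def laplacian (f : ℝ × ℝ → ℝ) (p : ℝ × ℝ) : ℝ := dx (dx f) p + dy (dy f) p

/-- `ρ` is the distributional solution, in the class `C([0, ∞); L²) ∩ L²_loc([0, ∞); H¹)`, of
`∂_t ρ + U(t, y) ∂_x ρ = Δ ρ` on `[0, ∞) × 𝕋²` with initial value `ρ 0`.
Since `∂_x U(t, y) = 0`, the transport term is `∂_x (U ρ)`. Values at `t < 0` play no role. -/
structure IsSolution (U : ℝ → ℝ → ℝ) (ρ : ℝ → ℝ × ℝ → ℝ) : Prop where
  periodic : ∀ t ≥ 0, TorusPeriodic (ρ t)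
  aestronglyMeasurable :
    AEStronglyMeasurable (fun q : ℝ × (ℝ × ℝ) => ρ q.1 q.2)
      (volume.restrict (Ioi 0 ×ˢ torusCell))
  memL2 : ∀ t ≥ 0, MemLp (ρ t) 2 (volume.restrict torusCell)
  continuous_L2 : ∀ t ≥ 0, Tendsto (fun s => normL2 (ρ s - ρ t)) (𝓝[Ici 0] t) (𝓝 0)
  memL2H1 : ∀ T > 0, ∫⁻ t in Ioc 0 T, sobolevNorm 1 (ρ t) ^ 2 < ⊤
  equation : ∀ φ : ℝ → ℝ × ℝ → ℝ, IsTestFunction φ →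
    (∫ t in Ioi (0 : ℝ), ∫ p in torusCell,
        ρ t p * (dt φ t p + U t p.2 * dx (φ t) p + laplacian (φ t) p))
      + ∫ p in torusCell, ρ 0 p * φ 0 p = 0

end TorusShear

end

/-!
# Shear flows do not mix to arbitrarily small scales in the presence of diffusion

Since `U` does not depend on `x`, the Fourier modes `f_k(t, y)` of `ρ` in `x` decouple:
`∂_t f_k = ∂_y² f_k - k² f_k - i k U f_k`. On the circle, `‖U f_k‖_{L²} ≤ ‖U‖_{L²} ‖f_k‖_{L^∞}`, and
the `L^∞` norm is controlled by the `ℓ¹` norm of the Fourier coefficients `a_l` of `f_k` in `y`.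

The argument rests on the growth of the gaps in the spectrum `{l²}` of `-∂_y²`. Let `μ = m² + m` be
the middle of a gap and `Q = ∑ (l² - μ) |a_l|²`, so that `Q ≤ 0` says that the Dirichlet quotient of
`f_k` is at most `μ`. Then
`Q' + 2 (μ + k²) Q ≤ -∑ (l² - μ)² |a_l|² + k² ‖U f_k‖²`, and by Cauchy–Schwarz
`(∑ |a_l|)² ≤ (∑ (l² - μ)⁻²) ∑ (l² - μ)² |a_l|²`, where the first factor is `O(m⁻²)`
(`summable_inv_gap_sq`). For `m` large the right hand side is nonpositive, so
`e^{2(μ + k²)t} Q(t)` is nonincreasing (`ShearMode.barrier`). Two things follow, at times after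
some `t₀` at which all modes are in `H¹`. The Dirichlet quotient of each mode stays bounded, hence
its `H⁻¹` and `L²` norms are comparable (`ShearMode.exists_le_mul`). A mode that is nonzero at
`t₀` is bounded below by an exponential (`ShearMode.exists_exp_le`), which also gives `ρ(t) ≠ 0`,
since `t₀` can be taken arbitrarily small.

On the other hand `‖f_K(t)‖ ≤ e^{-K²t} ‖f_K(0)‖` because the transport term does no work
(`ShearMode.energy_le`). So finitely many modes in `x` eventually carry at least half of the squared
`L²` norm of `ρ`, and the two norms of `ρ` are comparable for all large times
(`eventually_tsum_le`).

To work in the class `C_t L² ∩ L²_t H¹`, all differential inequalities are written for finitely many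
coefficients `a_l`, `l ∈ s`, with an error bounded by `∫ ‖f_k‖_{H¹}²` times a tail of
`∑ (1 + l²)⁻¹`, which tends to zero along the finite sets `s`. Each coefficient is absolutely
continuous in time, by testing the equation with `θ(t) cos(kx + ly + δ)`
(`IsSolution.coefficient_evolution`); the values `δ = 0` and `δ = π / 2` give its real and imaginary
parts.
-/

namespace TorusShear

/-! ### Weighted sequence estimates -/

lemma summable_inv_one_add_sq : Summable fun l : ℤ => (1 + (l : ℝ) ^ 2)⁻¹ := by
  have h1 : Summable fun l : ℤ => 1 / (l : ℝ) ^ 2 :=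
    Real.summable_one_div_int_pow.2 (by norm_num)
  have h2 : Summable fun l : ℤ => if l = 0 then (1 : ℝ) else 0 := (hasSum_ite_eq 0 1).summable
  refine Summable.of_nonneg_of_le (fun l => by positivity) (fun l => ?_) (h1.add h2)
  by_cases hl : l = 0
  · simp [hl]
  · have : (0 : ℝ) < (l : ℝ) ^ 2 := by positivity
    simp only [hl, if_false, add_zero, one_div]
    gcongr
    linarith

/-- The Cauchy–Schwarz inequality `(∑ b)² ≤ (∑ w⁻¹) (∑ w b²)`. -/
lemma summable_and_sq_tsum_le {ι : Type*} {w b : ι → ℝ} (hw : ∀ i, 0 < w i) (hb : ∀ i, 0 ≤ b i)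
    (hsw : Summable fun i => (w i)⁻¹) (hsb : Summable fun i => w i * b i ^ 2) :
    Summable b ∧ (∑' i, b i) ^ 2 ≤ (∑' i, (w i)⁻¹) * ∑' i, w i * b i ^ 2 := by
  set C := (∑' i, (w i)⁻¹) * ∑' i, w i * b i ^ 2 with hC
  have hC0 : 0 ≤ C := mul_nonneg (tsum_nonneg fun i => (inv_pos.2 (hw i)).le)
    (tsum_nonneg fun i => mul_nonneg (hw i).le (sq_nonneg _))
  have key : ∀ s : Finset ι, ∑ i ∈ s, b i ≤ √C := by
    intro s
    apply Real.le_sqrt_of_sq_le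
    calc (∑ i ∈ s, b i) ^ 2 ≤ (∑ i ∈ s, (w i)⁻¹) * ∑ i ∈ s, w i * b i ^ 2 := by
          refine Finset.sum_sq_le_sum_mul_sum_of_sq_le_mul s (fun i _ => (inv_pos.2 (hw i)).le)
            (fun i _ => mul_nonneg (hw i).le (sq_nonneg _)) (fun i _ => ?_)
          rw [← mul_assoc, inv_mul_cancel₀ (hw i).ne', one_mul]
      _ ≤ C := by
          refine mul_le_mul (hsw.sum_le_tsum s fun i _ => (inv_pos.2 (hw i)).le)
            (hsb.sum_le_tsum s fun i _ => mul_nonneg (hw i).le (sq_nonneg _))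
            (Finset.sum_nonneg fun i _ => mul_nonneg (hw i).le (sq_nonneg _))
            (tsum_nonneg fun i => (inv_pos.2 (hw i)).le)
  have hs : Summable b := summable_of_sum_le hb key
  refine ⟨hs, ?_⟩
  have := Real.tsum_le_of_sum_le hb key
  calc (∑' i, b i) ^ 2 ≤ √C ^ 2 := by
        gcongr
        exact tsum_nonneg hb
    _ = C := Real.sq_sqrt hC0

/-- The tail of `∑_l (1 + l²)⁻¹` outside the finite set `s` of frequencies. -/
noncomputable def tailWeight (s : Finset ℤ) : ℝ :=
  ∑' l : {l : ℤ // l ∉ s}, (1 + ((l : ℤ) : ℝ) ^ 2)⁻¹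

lemma tailWeight_nonneg (s : Finset ℤ) : 0 ≤ tailWeight s := tsum_nonneg fun _ => by positivity

lemma tendsto_tailWeight : Tendsto tailWeight atTop (𝓝 0) :=
  tendsto_tsum_compl_atTop_zero fun l : ℤ => (1 + (l : ℝ) ^ 2)⁻¹

lemma tailWeight_le (s : Finset ℤ) : tailWeight s ≤ tailWeight ∅ := by
  have h : tailWeight ∅ = ∑' l : ℤ, (1 + (l : ℝ) ^ 2)⁻¹ := by
    have := summable_inv_one_add_sq.sum_add_tsum_subtype_compl ∅
    simpa [tailWeight] using this
  rw [h, ← summable_inv_one_add_sq.sum_add_tsum_subtype_compl s]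
  have : 0 ≤ ∑ x ∈ s, (1 + (x : ℝ) ^ 2)⁻¹ := Finset.sum_nonneg fun _ _ => by positivity
  exact le_add_of_nonneg_left this

lemma tsum_eq_sum_add_tail {b : ℤ → ℝ} (hb : Summable b) (s : Finset ℤ) :
    ∑' l, b l = ∑ l ∈ s, b l + ∑' l : {l : ℤ // l ∉ s}, b l :=
  (hb.sum_add_tsum_subtype_compl s).symm

lemma summable_norm_of_H1 {a : ℤ → ℂ} (ha : Summable fun l : ℤ => (1 + (l : ℝ) ^ 2) * ‖a l‖ ^ 2) :
    Summable fun l => ‖a l‖ :=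
  (summable_and_sq_tsum_le (w := fun l : ℤ => 1 + (l : ℝ) ^ 2) (fun _ => by positivity)
    (fun _ => norm_nonneg _) summable_inv_one_add_sq ha).1

/-- The `ℓ¹` tail of a sequence is controlled by its `H¹` norm, with a constant that tends to
zero along the finite sets of frequencies. -/
lemma sq_tail_le {a : ℤ → ℂ} (ha : Summable fun l : ℤ => (1 + (l : ℝ) ^ 2) * ‖a l‖ ^ 2)
    (s : Finset ℤ) :
    (∑' l : {l : ℤ // l ∉ s}, ‖a l‖) ^ 2 ≤
      tailWeight s * ∑' l : ℤ, (1 + (l : ℝ) ^ 2) * ‖a l‖ ^ 2 := by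
  have h := (summable_and_sq_tsum_le (ι := {l : ℤ // l ∉ s})
    (w := fun l => 1 + ((l : ℤ) : ℝ) ^ 2) (b := fun l => ‖a l‖) (fun _ => by positivity)
    (fun _ => norm_nonneg _) (summable_inv_one_add_sq.subtype _) (ha.subtype _)).2
  refine h.trans (mul_le_mul_of_nonneg_left ?_ (tailWeight_nonneg s))
  rw [tsum_eq_sum_add_tail ha s]
  exact le_add_of_nonneg_left (Finset.sum_nonneg fun _ _ => by positivity)

lemma sq_tsum_norm_le {a : ℤ → ℂ} (ha : Summable fun l : ℤ => (1 + (l : ℝ) ^ 2) * ‖a l‖ ^ 2) :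
    (∑' l : ℤ, ‖a l‖) ^ 2 ≤ tailWeight ∅ * ∑' l : ℤ, (1 + (l : ℝ) ^ 2) * ‖a l‖ ^ 2 := by
  have h := sq_tail_le ha ∅
  have e := tsum_eq_sum_add_tail (summable_norm_of_H1 ha) ∅
  simp only [Finset.sum_empty, zero_add] at e
  rwa [← e] at h

/-! ### Spectral gaps of the Laplacian on the circle -/

/-- The distance of `l²` to the middle `m² + m` of a spectral gap is at least `m` times the distance
of `l` to one of the edges `±m`, `±(m + 1)` of the gap. At the edges the sum on the right contains
terms `1 / 0`, which are `0` and do no harm. -/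
lemma inv_gap_sq_le (m : ℕ) (hm : 1 ≤ m) (l : ℤ) :
    ((l : ℝ) ^ 2 - ((m : ℝ) ^ 2 + m)) ≠ 0 ∧
    ((((l : ℝ) ^ 2 - ((m : ℝ) ^ 2 + m)) ^ 2)⁻¹ ≤ (1 / (m : ℝ) ^ 2) *
      (1 / ((l + -m : ℤ) : ℝ) ^ 2 + 1 / ((l + (-m - 1) : ℤ) : ℝ) ^ 2 +
        (1 / ((l + m : ℤ) : ℝ) ^ 2 + 1 / ((l + (m + 1) : ℤ) : ℝ) ^ 2))) := by
  have hm0 : (1 : ℝ) ≤ m := by exact_mod_cast hm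
  -- the bound for one frequency follows from `d m ≤ |l² - (m² + m)|` for a suitable distance `d`
  have key : ∀ d : ℤ, d ≠ 0 → |(d : ℝ)| * m ≤ |(l : ℝ) ^ 2 - ((m : ℝ) ^ 2 + m)| →
      ((l : ℝ) ^ 2 - ((m : ℝ) ^ 2 + m)) ≠ 0 ∧
      (((l : ℝ) ^ 2 - ((m : ℝ) ^ 2 + m)) ^ 2)⁻¹ ≤ (1 / (m : ℝ) ^ 2) * (1 / (d : ℝ) ^ 2) := by
    intro d hd h
    have hd0 : 0 < |(d : ℝ)| := by positivity
    have h0 : 0 < |(d : ℝ)| * m := by positivity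
    refine ⟨fun h' => by rw [h', abs_zero] at h; linarith, ?_⟩
    rw [one_div_mul_one_div, ← one_div, ← sq_abs ((l : ℝ) ^ 2 - ((m : ℝ) ^ 2 + m)),
      ← sq_abs (d : ℝ), ← mul_pow]
    gcongr
    linarith
  have hm0' : (1 : ℤ) ≤ m := by exact_mod_cast hm
  rcases le_total 0 l with hl | hl
  · rcases le_or_gt l m with h | h
    · have hl' : (0 : ℝ) ≤ l := by exact_mod_cast hl
      have h' : (l : ℝ) ≤ m := by exact_mod_cast h
      obtain ⟨h1, h2⟩ := key (l + (-m - 1)) (by lia) (by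
        push_cast
        rw [abs_of_neg (by linarith : (l : ℝ) + (-m - 1) < 0),
          abs_of_neg (by nlinarith)]
        nlinarith)
      refine ⟨h1, h2.trans ?_⟩
      gcongr
      exact (le_add_of_nonneg_left (by positivity)).trans (le_add_of_nonneg_right (by positivity))
    · have h' : (m : ℝ) + 1 ≤ l := by exact_mod_cast h
      obtain ⟨h1, h2⟩ := key (l + -m) (by lia) (by
        push_cast
        rw [abs_of_pos (by linarith : (0 : ℝ) < l + -m), abs_of_pos (by nlinarith)]
        nlinarith)
      refine ⟨h1, h2.trans ?_⟩
      gcongr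
      exact (le_add_of_nonneg_right (by positivity)).trans (le_add_of_nonneg_right (by positivity))
  · rcases le_or_gt (-l) m with h | h
    · have hl' : (l : ℝ) ≤ 0 := by exact_mod_cast hl
      have h' : -(l : ℝ) ≤ m := by exact_mod_cast h
      obtain ⟨h1, h2⟩ := key (l + (m + 1)) (by lia) (by
        push_cast
        rw [abs_of_pos (by linarith : (0 : ℝ) < l + (m + 1)),
          abs_of_neg (by nlinarith)]
        nlinarith)
      refine ⟨h1, h2.trans ?_⟩
      gcongr
      exact (le_add_of_nonneg_left (by positivity)).trans (le_add_of_nonneg_left (by positivity))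
    · have h' : (m : ℝ) + 1 ≤ -l := by exact_mod_cast h
      obtain ⟨h1, h2⟩ := key (l + m) (by lia) (by
        push_cast
        rw [abs_of_neg (by linarith : (l : ℝ) + m < 0), abs_of_pos (by nlinarith)]
        nlinarith)
      refine ⟨h1, h2.trans ?_⟩
      gcongr
      exact (le_add_of_nonneg_right (by positivity)).trans (le_add_of_nonneg_left (by positivity))

lemma hasSum_inv_sq_add (j : ℤ) :
    HasSum (fun l : ℤ => 1 / ((l + j : ℤ) : ℝ) ^ 2) (∑' l : ℤ, 1 / (l : ℝ) ^ 2) := by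
  have h1 : Summable fun l : ℤ => 1 / (l : ℝ) ^ 2 :=
    Real.summable_one_div_int_pow.2 (by norm_num)
  have h := (Equiv.addRight j).hasSum_iff.2 h1.hasSum
  simpa [Function.comp_def] using h

/-- In the middle `m² + m` of a spectral gap, the resolvent of the Laplacian on the circle has norm
`O(1 / m)` from `L²` to the sequences with summable Fourier coefficients. -/
lemma summable_inv_gap_sq (m : ℕ) (hm : 1 ≤ m) :
    Summable (fun l : ℤ => (((l : ℝ) ^ 2 - ((m : ℝ) ^ 2 + m)) ^ 2)⁻¹) ∧
      ∑' l : ℤ, (((l : ℝ) ^ 2 - ((m : ℝ) ^ 2 + m)) ^ 2)⁻¹ ≤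
        (1 / (m : ℝ) ^ 2) * (4 * ∑' l : ℤ, 1 / (l : ℝ) ^ 2) := by
  have hsum := (((hasSum_inv_sq_add (-m)).add (hasSum_inv_sq_add (-m - 1))).add
    ((hasSum_inv_sq_add m).add (hasSum_inv_sq_add (m + 1)))).mul_left (1 / (m : ℝ) ^ 2)
  generalize ∑' l : ℤ, 1 / (l : ℝ) ^ 2 = C at hsum ⊢
  have hs : Summable (fun l : ℤ => (((l : ℝ) ^ 2 - ((m : ℝ) ^ 2 + m)) ^ 2)⁻¹) :=
    Summable.of_nonneg_of_le (fun l => by positivity) (fun l => (inv_gap_sq_le m hm l).2)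
      hsum.summable
  refine ⟨hs, (hasSum_le (fun l => (inv_gap_sq_le m hm l).2) hs.hasSum hsum).trans
    (le_of_eq ?_)⟩
  ring

/-! ### Evolution of a single Fourier mode in `x` -/

/-- The squared `H¹` norm of a sequence of Fourier coefficients in `y`. -/
noncomputable def sqH1 (a : ℤ → ℂ) : ℝ := ∑' l : ℤ, (1 + (l : ℝ) ^ 2) * ‖a l‖ ^ 2

lemma sqH1_nonneg (a : ℤ → ℂ) : 0 ≤ sqH1 a := tsum_nonneg fun _ => by positivity

/-- The `k`-th Fourier mode in `x` of a solution: `a t l` are its Fourier coefficients in `y`, and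
`g t l` those of its product with the shear profile. The product enters only through an
`L² × L^∞ → L²` bound with constant `M` and through the fact that `∫ U |f|²` is real. -/
structure ShearMode (k M : ℝ) (a g : ℝ → ℤ → ℂ) : Prop where
  nonneg : 0 ≤ M
  ac_re : ∀ l, ∀ T ≥ 0, AbsolutelyContinuousOnInterval (fun t => (a t l).re) 0 T
  ac_im : ∀ l, ∀ T ≥ 0, AbsolutelyContinuousOnInterval (fun t => (a t l).im) 0 T
  hasDerivAt : ∀ l : ℤ, ∀ᵐ t : ℝ, 0 < t → HasDerivAt (fun s => a s l)
    (-((k ^ 2 + (l : ℝ) ^ 2 : ℝ) : ℂ) * a t l - Complex.I * k * g t l) t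
  summable_sq : ∀ t ≥ 0, Summable fun l => ‖a t l‖ ^ 2
  summable_H1 : ∀ᵐ t : ℝ, 0 < t → Summable fun l : ℤ => (1 + (l : ℝ) ^ 2) * ‖a t l‖ ^ 2
  integrable_H1 : ∀ T ≥ 0, IntegrableOn (fun t => sqH1 (a t)) (Ioc 0 T)
  sum_sq_le : ∀ᵐ t : ℝ, 0 < t → (Summable fun l => ‖a t l‖) →
    ∀ s : Finset ℤ, ∑ l ∈ s, ‖g t l‖ ^ 2 ≤ M ^ 2 * (∑' l, ‖a t l‖) ^ 2
  im_tsum : ∀ᵐ t : ℝ, 0 < t → (Summable fun l => ‖a t l‖) →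
    (∑' l, (starRingEnd ℂ) (a t l) * g t l).im = 0

lemma absolutelyContinuousOnInterval_sum {ι : Type*} (s : Finset ι) {f : ι → ℝ → ℝ}
    {x y : ℝ} (hf : ∀ i, AbsolutelyContinuousOnInterval (f i) x y) :
    AbsolutelyContinuousOnInterval (fun t => ∑ i ∈ s, f i t) x y := by
  classical
  induction s using Finset.induction_on with
  | empty =>
    simp only [Finset.sum_empty]
    exact (contDiff_const (n := 1)).contDiffOn.absolutelyContinuousOnInterval
  | insert i s hi ih =>
    simp only [Finset.sum_insert hi]
    exact (hf i).fun_add ih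

/-- A differential inequality for a finite weighted sum of squares of Fourier coefficients,
in integrated form. -/
lemma ShearMode.weighted_le {k M : ℝ} {a g : ℝ → ℤ → ℂ} (h : ShearMode k M a g)
    {w : ℤ → ℝ} {c δ : ℝ} {s : Finset ℤ} (hc : 0 ≤ c) (hδ : 0 ≤ δ)
    (hw : ∀ᵐ t : ℝ, 0 < t →
      ∑ l ∈ s, w l * (2 * (c - (k ^ 2 + (l : ℝ) ^ 2)) * ‖a t l‖ ^ 2
        + 2 * k * ((starRingEnd ℂ) (a t l) * g t l).im) ≤ δ * sqH1 (a t))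
    {t₀ t : ℝ} (ht₀ : 0 ≤ t₀) (ht : t₀ ≤ t) :
    Real.exp (2 * c * t) * ∑ l ∈ s, w l * ‖a t l‖ ^ 2 ≤
      Real.exp (2 * c * t₀) * ∑ l ∈ s, w l * ‖a t₀ l‖ ^ 2
        + Real.exp (2 * c * t) * δ * ∫ τ in Ioc 0 t, sqH1 (a τ) := by
  have ht' : 0 ≤ t := ht₀.trans ht
  set V : ℝ → ℝ := fun τ => Real.exp (2 * c * τ) *
    ∑ l ∈ s, w l * ((a τ l).re * (a τ l).re + (a τ l).im * (a τ l).im) with hV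
  have hVa : ∀ τ, V τ = Real.exp (2 * c * τ) * ∑ l ∈ s, w l * ‖a τ l‖ ^ 2 := fun τ => by
    simp only [hV, Complex.sq_norm, Complex.normSq_apply]
  have hexp : ContDiff ℝ 1 fun τ : ℝ => Real.exp (2 * c * τ) := by fun_prop
  have hac0 : AbsolutelyContinuousOnInterval V 0 t := by
    refine AbsolutelyContinuousOnInterval.fun_mul
      hexp.contDiffOn.absolutelyContinuousOnInterval
      (absolutelyContinuousOnInterval_sum s fun l => ?_)
    exact (((h.ac_re l t ht').fun_mul (h.ac_re l t ht')).fun_add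
      ((h.ac_im l t ht').fun_mul (h.ac_im l t ht'))).const_mul _
  have hac : AbsolutelyContinuousOnInterval V t₀ t := by
    refine hac0.mono ?_
    rw [uIcc_of_le ht, uIcc_of_le ht']
    exact Icc_subset_Icc_left ht₀
  have hder : ∀ᵐ τ : ℝ, 0 < τ → deriv V τ = Real.exp (2 * c * τ) *
      ∑ l ∈ s, w l * (2 * (c - (k ^ 2 + (l : ℝ) ^ 2)) * ‖a τ l‖ ^ 2
        + 2 * k * ((starRingEnd ℂ) (a τ l) * g τ l).im) := by
    filter_upwards [ae_all_iff.2 h.hasDerivAt] with τ hτ hτ0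
    have hre : ∀ l : ℤ, HasDerivAt (fun s => (a s l).re)
        (-(k ^ 2 + (l : ℝ) ^ 2) * (a τ l).re + k * (g τ l).im) τ := fun l => by
      refine (Complex.reCLM.hasFDerivAt.comp_hasDerivAt τ (hτ l hτ0)).congr_deriv ?_
      rw [Complex.reCLM_apply, Complex.sub_re, ← Complex.ofReal_neg, Complex.re_ofReal_mul,
        mul_assoc, Complex.mul_re]
      simp
    have him : ∀ l : ℤ, HasDerivAt (fun s => (a s l).im)
        (-(k ^ 2 + (l : ℝ) ^ 2) * (a τ l).im - k * (g τ l).re) τ := fun l => by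
      refine (Complex.imCLM.hasFDerivAt.comp_hasDerivAt τ (hτ l hτ0)).congr_deriv ?_
      rw [Complex.imCLM_apply, Complex.sub_im, ← Complex.ofReal_neg, Complex.im_ofReal_mul,
        mul_assoc, Complex.mul_im]
      simp
    have hS := HasDerivAt.fun_sum (u := s) fun l _ =>
      (((hre l).fun_mul (hre l)).fun_add ((him l).fun_mul (him l))).const_mul (w l)
    have hE : HasDerivAt (fun τ : ℝ => Real.exp (2 * c * τ))
        (Real.exp (2 * c * τ) * (2 * c)) τ := by
      simpa using ((hasDerivAt_id τ).const_mul (2 * c)).exp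
    rw [(hE.fun_mul hS).deriv, mul_assoc, ← mul_add, Finset.mul_sum, ← Finset.sum_add_distrib]
    congr 1
    refine Finset.sum_congr rfl fun l _ => ?_
    simp only [Complex.sq_norm, Complex.normSq_apply, Complex.mul_im, Complex.conj_re,
      Complex.conj_im]
    ring
  have hle : ∫ τ in t₀..t, deriv V τ ≤ ∫ τ in t₀..t, Real.exp (2 * c * t) * δ * sqH1 (a τ) := by
    have hint : IntervalIntegrable (fun τ => sqH1 (a τ)) volume t₀ t :=
      (intervalIntegrable_iff_integrableOn_Ioc_of_le ht).2
        ((h.integrable_H1 t ht').mono_set (Ioc_subset_Ioc_left ht₀))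
    refine intervalIntegral.integral_mono_ae_restrict ht hac.intervalIntegrable_deriv
      (hint.const_mul _) ?_
    rw [EventuallyLE, ae_restrict_iff' measurableSet_Icc]
    have hne : ∀ᵐ τ : ℝ, τ ≠ 0 := by simp [ae_iff, measure_singleton]
    filter_upwards [hder, hw, hne] with τ h1 h2 h3 hτ
    have hτ0 : 0 < τ := lt_of_le_of_ne (ht₀.trans hτ.1) h3.symm
    rw [h1 hτ0, mul_assoc (Real.exp (2 * c * t))]
    have h4 : 0 ≤ δ * sqH1 (a τ) := mul_nonneg hδ (sqH1_nonneg _)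
    have h5 : Real.exp (2 * c * τ) ≤ Real.exp (2 * c * t) := by
      have := hτ.2
      gcongr
    exact (mul_le_mul_of_nonneg_left (h2 hτ0) (Real.exp_pos _).le).trans
      (mul_le_mul_of_nonneg_right h5 h4)
  rw [hac.integral_deriv_eq_sub, intervalIntegral.integral_const_mul,
    intervalIntegral.integral_of_le ht] at hle
  have hmono : ∫ τ in Ioc t₀ t, sqH1 (a τ) ≤ ∫ τ in Ioc 0 t, sqH1 (a τ) :=
    setIntegral_mono_set (h.integrable_H1 t ht') (ae_of_all _ fun _ => sqH1_nonneg _)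
      (Ioc_subset_Ioc_left ht₀).eventuallyLE
  have := mul_le_mul_of_nonneg_left hmono (mul_nonneg (Real.exp_pos (2 * c * t)).le hδ)
  rw [← hVa, ← hVa]
  linarith

/-! ### Energy estimate -/

/-- The transport term does no work: its contribution to the energy of finitely many coefficients
is bounded by a tail, which vanishes in the limit. -/
lemma abs_im_sum_le {M : ℝ} {a g : ℤ → ℂ} (hM : 0 ≤ M)
    (ha : Summable fun l : ℤ => (1 + (l : ℝ) ^ 2) * ‖a l‖ ^ 2)
    (hg : ∀ s : Finset ℤ, ∑ l ∈ s, ‖g l‖ ^ 2 ≤ M ^ 2 * (∑' l, ‖a l‖) ^ 2)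
    (him : (∑' l, (starRingEnd ℂ) (a l) * g l).im = 0) (s : Finset ℤ) :
    |∑ l ∈ s, ((starRingEnd ℂ) (a l) * g l).im| ≤
      M * √(tailWeight ∅ * tailWeight s) * sqH1 a := by
  have hs := summable_norm_of_H1 ha
  set A := ∑' l, ‖a l‖ with hA
  have hA0 : 0 ≤ A := tsum_nonneg fun _ => norm_nonneg _
  have hgl : ∀ l, ‖g l‖ ≤ M * A := fun l => by
    have := hg {l}
    rw [Finset.sum_singleton, ← mul_pow] at this
    exact le_of_sq_le_sq this (by positivity)
  have hle : ∀ l, ‖(starRingEnd ℂ) (a l) * g l‖ ≤ M * A * ‖a l‖ := fun l => by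
    rw [norm_mul, RCLike.norm_conj, mul_comm]
    exact mul_le_mul_of_nonneg_right (hgl l) (norm_nonneg _)
  have hsum : Summable fun l => (starRingEnd ℂ) (a l) * g l :=
    Summable.of_norm_bounded (hs.mul_left (M * A)) hle
  have hsplit := hsum.sum_add_tsum_subtype_compl s
  have h1 : |∑ l ∈ s, ((starRingEnd ℂ) (a l) * g l).im| ≤
      M * A * ∑' l : {l : ℤ // l ∉ s}, ‖a l‖ := by
    rw [← Complex.im_sum, eq_sub_of_add_eq hsplit, Complex.sub_im, him, zero_sub, abs_neg]
    refine (Complex.abs_im_le_norm _).trans ?_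
    rw [← tsum_mul_left]
    exact tsum_of_norm_bounded ((hs.subtype _).mul_left (M * A)).hasSum fun l => hle l
  refine h1.trans ?_
  rw [mul_assoc, mul_assoc]
  refine mul_le_mul_of_nonneg_left ?_ hM
  refine le_of_sq_le_sq ?_ (mul_nonneg (Real.sqrt_nonneg _) (sqH1_nonneg _))
  rw [mul_pow, mul_pow, Real.sq_sqrt (mul_nonneg (tailWeight_nonneg _) (tailWeight_nonneg _))]
  calc _ ≤ (tailWeight ∅ * sqH1 a) * (tailWeight s * sqH1 a) :=
        mul_le_mul (sq_tsum_norm_le ha) (sq_tail_le ha s) (sq_nonneg _)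
          (mul_nonneg (tailWeight_nonneg _) (sqH1_nonneg _))
    _ = _ := by ring

lemma ShearMode.energy_le {k M : ℝ} {a g : ℝ → ℤ → ℂ} (h : ShearMode k M a g) {t : ℝ}
    (ht : 0 ≤ t) :
    Real.exp (2 * k ^ 2 * t) * ∑' l, ‖a t l‖ ^ 2 ≤ ∑' l, ‖a 0 l‖ ^ 2 := by
  set δ : Finset ℤ → ℝ := fun s => 2 * |k| * (M * √(tailWeight ∅ * tailWeight s)) with hδ
  have hδ0 : ∀ s, 0 ≤ δ s := fun s => by have := h.nonneg; positivity
  have hδlim : Tendsto δ atTop (𝓝 0) := by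
    have : Tendsto (fun s => √(tailWeight ∅ * tailWeight s)) atTop (𝓝 0) := by
      have := (Real.continuous_sqrt.tendsto _).comp (tendsto_tailWeight.const_mul (tailWeight ∅))
      simpa [Function.comp_def] using this
    simpa using (this.const_mul M).const_mul (2 * |k|)
  have key : ∀ s : Finset ℤ, Real.exp (2 * k ^ 2 * t) * ∑ l ∈ s, ‖a t l‖ ^ 2 ≤
      ∑' l, ‖a 0 l‖ ^ 2 + Real.exp (2 * k ^ 2 * t) * δ s * ∫ τ in Ioc 0 t, sqH1 (a τ) := by
    intro s
    have := h.weighted_le (w := fun _ => 1) (c := k ^ 2) (δ := δ s) (s := s) (by positivity)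
      (hδ0 s) ?_ le_rfl ht
    · simp only [one_mul, mul_zero, Real.exp_zero] at this
      refine this.trans (add_le_add_left ?_ _)
      exact (h.summable_sq 0 le_rfl).sum_le_tsum s fun _ _ => by positivity
    · filter_upwards [h.summable_H1, h.sum_sq_le, h.im_tsum] with τ h1 h2 h3 hτ
      have h4 := abs_im_sum_le h.nonneg (h1 hτ) (h2 hτ (summable_norm_of_H1 (h1 hτ)))
        (h3 hτ (summable_norm_of_H1 (h1 hτ))) s
      calc _ ≤ ∑ l ∈ s, 2 * k * ((starRingEnd ℂ) (a τ l) * g τ l).im := by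
            refine Finset.sum_le_sum fun l _ => ?_
            have : 0 ≤ (l : ℝ) ^ 2 * ‖a τ l‖ ^ 2 := by positivity
            linarith
        _ = 2 * k * ∑ l ∈ s, ((starRingEnd ℂ) (a τ l) * g τ l).im := by rw [Finset.mul_sum]
        _ ≤ |2 * k * ∑ l ∈ s, ((starRingEnd ℂ) (a τ l) * g τ l).im| := le_abs_self _
        _ = 2 * |k| * |∑ l ∈ s, ((starRingEnd ℂ) (a τ l) * g τ l).im| := by
            rw [abs_mul, abs_mul, abs_two]
        _ ≤ 2 * |k| * (M * √(tailWeight ∅ * tailWeight s) * sqH1 (a τ)) := by gcongr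
        _ = δ s * sqH1 (a τ) := by rw [hδ]; ring
  have hL : Tendsto (fun s : Finset ℤ => Real.exp (2 * k ^ 2 * t) * ∑ l ∈ s, ‖a t l‖ ^ 2) atTop
      (𝓝 (Real.exp (2 * k ^ 2 * t) * ∑' l, ‖a t l‖ ^ 2)) :=
    ((h.summable_sq t ht).hasSum).const_mul _
  have hR := ((hδlim.const_mul (Real.exp (2 * k ^ 2 * t))).mul_const
    (∫ τ in Ioc 0 t, sqH1 (a τ))).const_add (∑' l, ‖a 0 l‖ ^ 2)
  simp only [mul_zero, zero_mul, add_zero] at hR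
  exact le_of_tendsto_of_tendsto' hL hR key

/-! ### Spectral gap barrier -/

/-- The barrier inequality for finitely many coefficients: up to a tail, the damping
`-∑ (l² - μ)² |a_l|²` absorbs the transport term. -/
lemma gap_sum_le {k M : ℝ} {m : ℕ} (hm : 1 ≤ m) {a g : ℤ → ℂ}
    (hgap : 2 * (k ^ 2 * M ^ 2) * ∑' l : ℤ, (((l : ℝ) ^ 2 - ((m : ℝ) ^ 2 + m)) ^ 2)⁻¹ ≤ 1)
    (ha : Summable fun l : ℤ => (1 + (l : ℝ) ^ 2) * ‖a l‖ ^ 2)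
    (hg : ∀ s : Finset ℤ, ∑ l ∈ s, ‖g l‖ ^ 2 ≤ M ^ 2 * (∑' l, ‖a l‖) ^ 2) (s : Finset ℤ) :
    ∑ l ∈ s, ((l : ℝ) ^ 2 - ((m : ℝ) ^ 2 + m)) *
      (2 * ((m : ℝ) ^ 2 + m + k ^ 2 - (k ^ 2 + (l : ℝ) ^ 2)) * ‖a l‖ ^ 2
        + 2 * k * ((starRingEnd ℂ) (a l) * g l).im) ≤
      2 * (k ^ 2 * M ^ 2) * tailWeight s * sqH1 a := by
  set μ : ℝ := (m : ℝ) ^ 2 + m with hμ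
  set X := ∑ l ∈ s, ((l : ℝ) ^ 2 - μ) ^ 2 * ‖a l‖ ^ 2 with hX
  set S := ∑' l : ℤ, (((l : ℝ) ^ 2 - μ) ^ 2)⁻¹ with hS
  have hX0 : 0 ≤ X := Finset.sum_nonneg fun _ _ => by positivity
  have h1 : ∑ l ∈ s, ((l : ℝ) ^ 2 - μ) *
      (2 * (μ + k ^ 2 - (k ^ 2 + (l : ℝ) ^ 2)) * ‖a l‖ ^ 2
        + 2 * k * ((starRingEnd ℂ) (a l) * g l).im) ≤ -X + k ^ 2 * ∑ l ∈ s, ‖g l‖ ^ 2 := by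
    rw [hX, Finset.mul_sum, ← Finset.sum_neg_distrib, ← Finset.sum_add_distrib]
    refine Finset.sum_le_sum fun l _ => ?_
    have h2 : |((starRingEnd ℂ) (a l) * g l).im| ≤ ‖a l‖ * ‖g l‖ := by
      refine (Complex.abs_im_le_norm _).trans ?_
      rw [norm_mul, RCLike.norm_conj]
    have h3 : ((l : ℝ) ^ 2 - μ) * k * ((starRingEnd ℂ) (a l) * g l).im ≤
        |((l : ℝ) ^ 2 - μ)| * |k| * (‖a l‖ * ‖g l‖) := by
      refine (le_abs_self _).trans ?_
      rw [abs_mul, abs_mul]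
      gcongr
    have h4 := sq_nonneg (|(l : ℝ) ^ 2 - μ| * ‖a l‖ - |k| * ‖g l‖)
    have h5 := sq_abs ((l : ℝ) ^ 2 - μ)
    have h6 := sq_abs k
    have h7 : (|(l : ℝ) ^ 2 - μ| * ‖a l‖ - |k| * ‖g l‖) ^ 2 = ((l : ℝ) ^ 2 - μ) ^ 2 * ‖a l‖ ^ 2
        + k ^ 2 * ‖g l‖ ^ 2 - 2 * (|((l : ℝ) ^ 2 - μ)| * |k| * (‖a l‖ * ‖g l‖)) := by
      rw [← h5, ← h6]; ring
    nlinarith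
  have hA : ∑' l, ‖a l‖ = ∑ l ∈ s, ‖a l‖ + ∑' l : {l : ℤ // l ∉ s}, ‖a l‖ :=
    tsum_eq_sum_add_tail (summable_norm_of_H1 ha) s
  have h2 : (∑ l ∈ s, ‖a l‖) ^ 2 ≤ S * X := by
    calc (∑ l ∈ s, ‖a l‖) ^ 2 ≤
        (∑ l ∈ s, (((l : ℝ) ^ 2 - μ) ^ 2)⁻¹) * ∑ l ∈ s, ((l : ℝ) ^ 2 - μ) ^ 2 * ‖a l‖ ^ 2 := by
          refine Finset.sum_sq_le_sum_mul_sum_of_sq_le_mul s (fun i _ => by positivity)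
            (fun i _ => by positivity) (fun l _ => le_of_eq ?_)
          have := (inv_gap_sq_le m hm l).1
          rw [← hμ] at this
          field_simp
      _ ≤ S * X := mul_le_mul_of_nonneg_right
          ((summable_inv_gap_sq m hm).1.sum_le_tsum s fun _ _ => by positivity) hX0
  have h3 := sq_tail_le ha s
  set B := ∑ l ∈ s, ‖a l‖
  set D := ∑' l : {l : ℤ // l ∉ s}, ‖a l‖
  have h4 : (∑' l, ‖a l‖) ^ 2 ≤ 2 * (S * X) + 2 * (tailWeight s * sqH1 a) := by
    rw [hA]
    have h3' : D ^ 2 ≤ tailWeight s * sqH1 a := h3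
    nlinarith [sq_nonneg (B - D)]
  have h5 : k ^ 2 * ∑ l ∈ s, ‖g l‖ ^ 2 ≤
      k ^ 2 * M ^ 2 * (2 * (S * X) + 2 * (tailWeight s * sqH1 a)) := by
    rw [mul_assoc]
    exact mul_le_mul_of_nonneg_left ((hg s).trans (mul_le_mul_of_nonneg_left h4 (sq_nonneg _)))
      (sq_nonneg _)
  have h6 : 2 * (k ^ 2 * M ^ 2) * S * X ≤ X := mul_le_of_le_one_left hX0 hgap
  linarith

/-- **Spectral gap barrier.** If at time `t₀` the Dirichlet quotient of the mode lies below the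
middle `m² + m` of a sufficiently wide spectral gap, then it stays below, and the mode decays at
most at the corresponding exponential rate. -/
lemma ShearMode.barrier {k M : ℝ} {a g : ℝ → ℤ → ℂ} (h : ShearMode k M a g)
    {m : ℕ} (hm : 1 ≤ m)
    (hgap : 2 * (k ^ 2 * M ^ 2) * ∑' l : ℤ, (((l : ℝ) ^ 2 - ((m : ℝ) ^ 2 + m)) ^ 2)⁻¹ ≤ 1)
    {t₀ t : ℝ} (ht₀ : 0 ≤ t₀) (ht : t₀ ≤ t)
    (hs : Summable fun l : ℤ => (l : ℝ) ^ 2 * ‖a t₀ l‖ ^ 2) :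
    (Summable fun l : ℤ => (l : ℝ) ^ 2 * ‖a t l‖ ^ 2) ∧
      Real.exp (2 * ((m : ℝ) ^ 2 + m + k ^ 2) * t) *
        (∑' l : ℤ, (l : ℝ) ^ 2 * ‖a t l‖ ^ 2 - ((m : ℝ) ^ 2 + m) * ∑' l, ‖a t l‖ ^ 2) ≤
      Real.exp (2 * ((m : ℝ) ^ 2 + m + k ^ 2) * t₀) *
        (∑' l : ℤ, (l : ℝ) ^ 2 * ‖a t₀ l‖ ^ 2 - ((m : ℝ) ^ 2 + m) * ∑' l, ‖a t₀ l‖ ^ 2) := by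
  set μ : ℝ := (m : ℝ) ^ 2 + m with hμ
  have hμ0 : 0 ≤ μ := by positivity
  set c := μ + k ^ 2 with hc
  set K := 2 * (k ^ 2 * M ^ 2) with hK
  have hK0 : 0 ≤ K := by positivity
  set J := ∫ τ in Ioc 0 t, sqH1 (a τ) with hJ
  have hJ0 : 0 ≤ J := integral_nonneg fun _ => sqH1_nonneg _
  have ht' := ht₀.trans ht
  have hsplit : ∀ (τ : ℝ) (s : Finset ℤ), ∑ l ∈ s, ((l : ℝ) ^ 2 - μ) * ‖a τ l‖ ^ 2 =
      ∑ l ∈ s, (l : ℝ) ^ 2 * ‖a τ l‖ ^ 2 - μ * ∑ l ∈ s, ‖a τ l‖ ^ 2 := fun τ s => by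
    rw [Finset.mul_sum, ← Finset.sum_sub_distrib]
    exact Finset.sum_congr rfl fun _ _ => by ring
  have key : ∀ s : Finset ℤ,
      Real.exp (2 * c * t) * ∑ l ∈ s, ((l : ℝ) ^ 2 - μ) * ‖a t l‖ ^ 2 ≤
      Real.exp (2 * c * t₀) * ∑ l ∈ s, ((l : ℝ) ^ 2 - μ) * ‖a t₀ l‖ ^ 2
        + Real.exp (2 * c * t) * (K * tailWeight s) * J := by
    intro s
    refine h.weighted_le (by positivity) (mul_nonneg hK0 (tailWeight_nonneg s)) ?_ ht₀ ht
    filter_upwards [h.summable_H1, h.sum_sq_le] with τ h1 h2 hτ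
    exact gap_sum_le hm hgap (h1 hτ) (h2 hτ (summable_norm_of_H1 (h1 hτ))) s
  have hsum : Summable fun l : ℤ => (l : ℝ) ^ 2 * ‖a t l‖ ^ 2 := by
    refine summable_of_sum_le (fun l => by positivity) (c := μ * ∑' l, ‖a t l‖ ^ 2 +
      (Real.exp (2 * c * t))⁻¹ * (Real.exp (2 * c * t₀) * ∑' l : ℤ, (l : ℝ) ^ 2 * ‖a t₀ l‖ ^ 2
        + Real.exp (2 * c * t) * (K * tailWeight ∅) * J)) fun s => ?_
    have h1 := key s
    rw [hsplit, hsplit] at h1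
    have h2 : ∑ l ∈ s, ‖a t l‖ ^ 2 ≤ ∑' l, ‖a t l‖ ^ 2 :=
      (h.summable_sq t ht').sum_le_tsum s fun _ _ => by positivity
    have h3 : ∑ l ∈ s, (l : ℝ) ^ 2 * ‖a t₀ l‖ ^ 2 - μ * ∑ l ∈ s, ‖a t₀ l‖ ^ 2 ≤
        ∑' l : ℤ, (l : ℝ) ^ 2 * ‖a t₀ l‖ ^ 2 := by
      have h4 := hs.sum_le_tsum s fun _ _ => by positivity
      have h5 : 0 ≤ μ * ∑ l ∈ s, ‖a t₀ l‖ ^ 2 :=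
        mul_nonneg hμ0 (Finset.sum_nonneg fun _ _ => by positivity)
      linarith
    have h6 : Real.exp (2 * c * t) * (∑ l ∈ s, (l : ℝ) ^ 2 * ‖a t l‖ ^ 2
        - μ * ∑ l ∈ s, ‖a t l‖ ^ 2) ≤ Real.exp (2 * c * t₀) *
          ∑' l : ℤ, (l : ℝ) ^ 2 * ‖a t₀ l‖ ^ 2
        + Real.exp (2 * c * t) * (K * tailWeight ∅) * J := by
      refine h1.trans (add_le_add (mul_le_mul_of_nonneg_left h3 (Real.exp_pos _).le) ?_)
      have := tailWeight_le s
      gcongr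
    rw [← le_inv_mul_iff₀ (Real.exp_pos _)] at h6
    have h7 := mul_le_mul_of_nonneg_left h2 hμ0
    linarith
  refine ⟨hsum, ?_⟩
  have hlim : ∀ τ : ℝ, 0 ≤ τ → (Summable fun l : ℤ => (l : ℝ) ^ 2 * ‖a τ l‖ ^ 2) →
      Tendsto (fun s : Finset ℤ => Real.exp (2 * c * τ) *
        ∑ l ∈ s, ((l : ℝ) ^ 2 - μ) * ‖a τ l‖ ^ 2) atTop
      (𝓝 (Real.exp (2 * c * τ) *
        (∑' l : ℤ, (l : ℝ) ^ 2 * ‖a τ l‖ ^ 2 - μ * ∑' l, ‖a τ l‖ ^ 2))) := by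
    intro τ hτ hsτ
    simp only [hsplit]
    exact (Tendsto.sub hsτ.hasSum ((h.summable_sq τ hτ).hasSum.const_mul μ)).const_mul _
  have hR := (hlim t₀ ht₀ hs).add (((tendsto_tailWeight.const_mul K).const_mul
    (Real.exp (2 * c * t))).mul_const J)
  simp only [mul_zero, zero_mul, add_zero] at hR
  exact le_of_tendsto_of_tendsto' (hlim t ht' hsum) hR key

/-- Spectral gaps as wide as needed exist arbitrarily far out. -/
lemma exists_gap (k M L : ℝ) : ∃ m : ℕ, 1 ≤ m ∧ L ≤ (m : ℝ) ^ 2 + m ∧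
    2 * (k ^ 2 * M ^ 2) * ∑' l : ℤ, (((l : ℝ) ^ 2 - ((m : ℝ) ^ 2 + m)) ^ 2)⁻¹ ≤ 1 := by
  set C := ∑' l : ℤ, 1 / (l : ℝ) ^ 2 with hC
  have hC0 : 0 ≤ C := tsum_nonneg fun _ => by positivity
  obtain ⟨m, hm⟩ := exists_nat_ge (max 1 (max L (2 * (k ^ 2 * M ^ 2) * (4 * C))))
  have h1 : (1 : ℝ) ≤ m := (le_max_left _ _).trans hm
  have h2 : L ≤ m := (le_max_left _ _).trans ((le_max_right _ _).trans hm)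
  have h3 : 2 * (k ^ 2 * M ^ 2) * (4 * C) ≤ m :=
    (le_max_right _ _).trans ((le_max_right _ _).trans hm)
  have hm1 : 1 ≤ m := by exact_mod_cast h1
  refine ⟨m, hm1, by nlinarith, ?_⟩
  have h4 := mul_le_mul_of_nonneg_left (summable_inv_gap_sq m hm1).2
    (by positivity : 0 ≤ 2 * (k ^ 2 * M ^ 2))
  refine h4.trans ?_
  rw [← hC]
  have h5 : 2 * (k ^ 2 * M ^ 2) * (1 / (m : ℝ) ^ 2 * (4 * C)) =
      (2 * (k ^ 2 * M ^ 2) * (4 * C)) / (m : ℝ) ^ 2 := by ring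
  rw [h5, div_le_one (by positivity)]
  nlinarith

/-! ### Fourier coefficients on the circle -/

/-- Lebesgue measure on one period of the circle. -/
noncomputable abbrev circleMeasure : Measure ℝ := volume.restrict circleCell

instance : IsFiniteMeasure circleMeasure :=
  inferInstanceAs (IsFiniteMeasure (volume.restrict (Ioc (-Real.pi) Real.pi)))

lemma sq_eLpNorm_two {α E : Type*} [MeasurableSpace α] [NormedAddCommGroup E] (μ : Measure α)
    (f : α → E) : eLpNorm f 2 μ ^ 2 = ∫⁻ x, ‖f x‖ₑ ^ 2 ∂μ := by
  have h := eLpNorm_nnreal_pow_eq_lintegral (f := f) (μ := μ) (p := 2) (by norm_num)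
  simpa using h

/-- The Fourier coefficient `(2π)⁻¹ ∫ h(y) e^{-ily} dy` on the circle. -/
noncomputable def circleCoeff (h : ℝ → ℂ) (l : ℤ) : ℂ :=
  (1 / (2 * Real.pi) : ℂ) * ∫ y, h y * Complex.exp (-Complex.I * (l * y)) ∂circleMeasure

lemma neg_pi_lt_pi : -Real.pi < Real.pi := by linarith [Real.pi_pos]

lemma circleCoeff_eq_fourierCoeffOn (h : ℝ → ℂ) (l : ℤ) :
    circleCoeff h l = fourierCoeffOn neg_pi_lt_pi h l := by
  rw [fourierCoeffOn_eq_integral, circleCoeff, intervalIntegral.integral_of_le neg_pi_lt_pi.le,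
    Complex.real_smul]
  congr 1
  · push_cast; ring
  · refine integral_congr_ae (ae_of_all _ fun y => ?_)
    simp only [smul_eq_mul, fourier_coe_apply]
    rw [mul_comm]
    congr 2
    have : (Real.pi : ℂ) ≠ 0 := by exact_mod_cast Real.pi_ne_zero
    push_cast
    field_simp
    ring

lemma norm_exp_neg_I_mul (x : ℝ) : ‖Complex.exp (-Complex.I * x)‖ = 1 := by
  rw [neg_mul, mul_comm, ← neg_mul, ← Complex.ofReal_neg]
  exact Complex.norm_exp_ofReal_mul_I _

lemma norm_exp_neg_I_mul_int (l : ℤ) (y : ℝ) : ‖Complex.exp (-Complex.I * (l * y))‖ = 1 := by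
  exact_mod_cast norm_exp_neg_I_mul (l * y)

lemma integrable_mul_exp {h : ℝ → ℂ} (hh : Integrable h circleMeasure) (l : ℤ) :
    Integrable (fun y : ℝ => h y * Complex.exp (-Complex.I * (l * y))) circleMeasure := by
  refine hh.mul_bdd (c := 1) (Continuous.aestronglyMeasurable (by fun_prop))
    (ae_of_all _ fun y => (norm_exp_neg_I_mul_int l y).le)

lemma circleCoeff_sub {h₁ h₂ : ℝ → ℂ} (hh₁ : Integrable h₁ circleMeasure)
    (hh₂ : Integrable h₂ circleMeasure) (l : ℤ) :
    circleCoeff (fun y => h₁ y - h₂ y) l = circleCoeff h₁ l - circleCoeff h₂ l := by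
  simp only [circleCoeff, sub_mul]
  rw [integral_sub (integrable_mul_exp hh₁ l) (integrable_mul_exp hh₂ l), mul_sub]

lemma hasSum_sq_circleCoeff {h : ℝ → ℂ} (hh : MemLp h 2 circleMeasure) :
    HasSum (fun l => ‖circleCoeff h l‖ ^ 2)
      ((2 * Real.pi)⁻¹ * ∫ y, ‖h y‖ ^ 2 ∂circleMeasure) := by
  have := hasSum_sq_fourierCoeffOn neg_pi_lt_pi hh
  simp only [circleCoeff_eq_fourierCoeffOn]
  convert this using 1
  rw [smul_eq_mul, intervalIntegral.integral_of_le neg_pi_lt_pi.le, sub_neg_eq_add, two_mul]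
  rfl

lemma ofReal_integral_sq {α E : Type*} [MeasurableSpace α] [NormedAddCommGroup E] {μ : Measure α}
    {f : α → E} (hf : MemLp f 2 μ) :
    ENNReal.ofReal (∫ x, ‖f x‖ ^ 2 ∂μ) = ∫⁻ x, ‖f x‖ₑ ^ 2 ∂μ := by
  rw [ofReal_integral_eq_lintegral_ofReal ((memLp_two_iff_integrable_sq_norm hf.1).1 hf)
    (ae_of_all _ fun _ => by positivity)]
  refine lintegral_congr fun x => ?_
  rw [ENNReal.ofReal_pow (norm_nonneg _), ofReal_norm]

/-- Parseval's identity on the circle. -/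
lemma tsum_enorm_sq_circleCoeff {h : ℝ → ℂ} (hh : MemLp h 2 circleMeasure) :
    ∑' l, ‖circleCoeff h l‖ₑ ^ 2 =
      ENNReal.ofReal (2 * Real.pi)⁻¹ * ∫⁻ y, ‖h y‖ₑ ^ 2 ∂circleMeasure := by
  have := hasSum_sq_circleCoeff hh
  rw [← ofReal_integral_sq hh, ← ENNReal.ofReal_mul (by positivity), ← this.tsum_eq,
    ENNReal.ofReal_tsum_of_nonneg (fun _ => by positivity) this.summable]
  refine tsum_congr fun l => ?_
  rw [ENNReal.ofReal_pow (norm_nonneg _), ofReal_norm]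

lemma ae_eq_zero_of_circleCoeff_eq_zero {h : ℝ → ℂ} (hh : MemLp h 2 circleMeasure)
    (h0 : ∀ l, circleCoeff h l = 0) : h =ᵐ[circleMeasure] 0 := by
  have := (tsum_enorm_sq_circleCoeff hh).symm
  simp only [h0, enorm_zero, ne_eq, OfNat.ofNat_ne_zero, not_false_eq_true, zero_pow,
    tsum_zero, mul_eq_zero, ENNReal.ofReal_eq_zero, not_le.2 (by positivity : 0 < (2 * Real.pi)⁻¹),
    false_or] at this
  rw [lintegral_eq_zero_iff' (hh.1.enorm.pow_const 2)] at this
  filter_upwards [this] with y hy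
  simpa using hy

lemma circleCoeff_exp (m l : ℤ) :
    circleCoeff (fun y => Complex.exp (Complex.I * (m * y))) l = if l = m then 1 else 0 := by
  have hpi : (Real.pi : ℂ) ≠ 0 := by exact_mod_cast Real.pi_ne_zero
  have e : ∀ y : ℝ, Complex.exp (Complex.I * (m * y)) * Complex.exp (-Complex.I * (l * y)) =
      Complex.exp ((Complex.I * (m - l)) * y) := fun y => by
    rw [← Complex.exp_add]; congr 1; ring
  rw [circleCoeff]
  simp only [e]
  rw [circleMeasure, circleCell, ← intervalIntegral.integral_of_le neg_pi_lt_pi.le]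
  split_ifs with hlm
  · subst hlm
    simp only [sub_self, mul_zero, zero_mul, Complex.exp_zero]
    rw [intervalIntegral.integral_const, Complex.real_smul]
    push_cast
    field_simp
    ring
  · have hc : Complex.I * ((m : ℂ) - l) ≠ 0 := by
      refine mul_ne_zero Complex.I_ne_zero (sub_ne_zero.2 ?_)
      exact_mod_cast Ne.symm hlm
    rw [integral_exp_mul_complex hc]
    have : Complex.exp (Complex.I * (m - l) * (Real.pi : ℝ)) =
        Complex.exp (Complex.I * (m - l) * ((-Real.pi : ℝ) : ℂ)) := by
      rw [Complex.exp_eq_exp_iff_exists_int]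
      exact ⟨m - l, by push_cast; ring⟩
    rw [this]
    simp

/-- A summable Fourier series on the circle has the prescribed Fourier coefficients. -/
lemma circleCoeff_tsum {a : ℤ → ℂ} (ha : Summable fun l => ‖a l‖) (n : ℤ) :
    circleCoeff (fun y => ∑' l, a l * Complex.exp (Complex.I * (l * y))) n = a n := by
  have hn : ∀ (l : ℤ) (y : ℝ), ‖Complex.exp (Complex.I * (l * y))‖ = 1 := fun l y => by
    have := Complex.norm_exp_ofReal_mul_I (l * y)
    rw [mul_comm]
    exact_mod_cast this
  have hterm : ∀ l : ℤ, ∫ y : ℝ, a l * Complex.exp (Complex.I * (l * y)) *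
      Complex.exp (-Complex.I * (n * y)) ∂circleMeasure =
      a l * (2 * Real.pi) * (if n = l then 1 else 0) := fun l => by
    have hpi : (Real.pi : ℂ) ≠ 0 := by exact_mod_cast Real.pi_ne_zero
    rw [← circleCoeff_exp, circleCoeff]
    simp only [mul_assoc]
    rw [integral_const_mul, ← mul_assoc (2 : ℂ), ← mul_assoc (2 * (Real.pi : ℂ)),
      mul_one_div_cancel (mul_ne_zero two_ne_zero hpi), one_mul]
  have h := hasSum_integral_of_summable_integral_norm (μ := circleMeasure)
    (F := fun (l : ℤ) (y : ℝ) => a l * Complex.exp (Complex.I * (l * y)) *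
      Complex.exp (-Complex.I * (n * y)))
    (fun l => by
      refine Integrable.of_bound (Continuous.aestronglyMeasurable (by fun_prop)) ‖a l‖
        (ae_of_all _ fun y => ?_)
      rw [norm_mul, norm_mul, hn, norm_exp_neg_I_mul_int, mul_one, mul_one])
    (by
      simp only [norm_mul, hn, norm_exp_neg_I_mul_int, mul_one, integral_const, smul_eq_mul]
      exact ha.mul_left _)
  simp only [hterm] at h
  have h2 := h.unique ((hasSum_ite_eq n (a n * (2 * Real.pi))).congr_fun ?_)
  · rw [circleCoeff]
    simp only [← tsum_mul_right]
    rw [h2]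
    have hpi : (Real.pi : ℂ) ≠ 0 := by exact_mod_cast Real.pi_ne_zero
    field_simp
  · intro l
    by_cases hl : l = n
    · subst hl; simp
    · simp [hl, Ne.symm hl]

lemma continuous_fourier_tsum {a : ℤ → ℂ} (ha : Summable fun l => ‖a l‖) :
    Continuous fun y : ℝ => ∑' l : ℤ, a l * Complex.exp (Complex.I * (l * y)) := by
  refine continuous_tsum (fun l => by fun_prop) ha fun l y => ?_
  have := Complex.norm_exp_ofReal_mul_I (l * y)
  rw [norm_mul, mul_comm Complex.I]
  push_cast at this
  rw [this, mul_one]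

lemma norm_fourier_tsum_le {a : ℤ → ℂ} (ha : Summable fun l => ‖a l‖) (y : ℝ) :
    ‖∑' l : ℤ, a l * Complex.exp (Complex.I * (l * y))‖ ≤ ∑' l, ‖a l‖ := by
  refine tsum_of_norm_bounded ha.hasSum fun l => ?_
  have := Complex.norm_exp_ofReal_mul_I (l * y)
  rw [norm_mul, mul_comm Complex.I]
  push_cast at this
  rw [this, mul_one]

/-- Fourier inversion on the circle for summable coefficients. -/
lemma ae_eq_fourier_tsum {h : ℝ → ℂ} (hh : MemLp h 2 circleMeasure)
    (ha : Summable fun l => ‖circleCoeff h l‖) :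
    ∀ᵐ y ∂circleMeasure, h y = ∑' l : ℤ, circleCoeff h l * Complex.exp (Complex.I * (l * y)) := by
  have hD : MemLp (fun y : ℝ => ∑' l : ℤ, circleCoeff h l * Complex.exp (Complex.I * (l * y))) 2
      circleMeasure :=
    MemLp.of_bound (continuous_fourier_tsum ha).aestronglyMeasurable _
      (ae_of_all _ (norm_fourier_tsum_le ha))
  have := ae_eq_zero_of_circleCoeff_eq_zero (hh.sub hD) fun l => by
    have h1 := circleCoeff_sub (hh.integrable (by norm_num)) (hD.integrable (by norm_num)) l
    rw [circleCoeff_tsum ha, sub_self] at h1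
    exact h1
  filter_upwards [this] with y hy
  exact sub_eq_zero.1 hy

/-- Multiplication by a real square integrable function `V` on the circle, in terms of Fourier
coefficients: it is bounded from `ℓ¹` to `ℓ²`, and it is symmetric. -/
lemma circleCoeff_mul_real {φ : ℝ → ℂ} {V : ℝ → ℝ} (hφ : MemLp φ 2 circleMeasure)
    (hV : MemLp V 2 circleMeasure) (ha : Summable fun l => ‖circleCoeff φ l‖) :
    (∀ s : Finset ℤ, ∑ l ∈ s, ‖circleCoeff (fun y => V y * φ y) l‖ ^ 2 ≤
      (∫ y, V y ^ 2 ∂circleMeasure) * (∑' l, ‖circleCoeff φ l‖) ^ 2) ∧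
    (∑' l, (starRingEnd ℂ) (circleCoeff φ l) * circleCoeff (fun y => V y * φ y) l).im = 0 := by
  set A := ∑' l, ‖circleCoeff φ l‖ with hA
  have hinv := ae_eq_fourier_tsum hφ ha
  have hbd : ∀ᵐ y ∂circleMeasure, ‖φ y‖ ≤ A := by
    filter_upwards [hinv] with y hy
    rw [hy]
    exact norm_fourier_tsum_le ha y
  have hV' : MemLp (fun y => (V y : ℂ)) 2 circleMeasure := hV.ofReal
  have hVφ : MemLp (fun y => V y * φ y) 2 circleMeasure := by
    refine MemLp.of_le_mul (c := A) hV' (hV'.1.mul hφ.1) ?_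
    filter_upwards [hbd] with y hy
    rw [norm_mul, mul_comm]
    gcongr
  have hVφ1 : Integrable (fun y => V y * φ y) circleMeasure := hVφ.integrable (by norm_num)
  constructor
  · intro s
    have h1 := hasSum_sq_circleCoeff hVφ
    refine (h1.summable.sum_le_tsum s fun _ _ => by positivity).trans ?_
    rw [h1.tsum_eq]
    have h2 : ∫ y, ‖V y * φ y‖ ^ 2 ∂circleMeasure ≤ ∫ y, V y ^ 2 * A ^ 2 ∂circleMeasure := by
      refine integral_mono_ae ((memLp_two_iff_integrable_sq_norm hVφ.1).1 hVφ)
        (hV.integrable_sq.mul_const _) ?_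
      filter_upwards [hbd] with y hy
      rw [norm_mul, mul_pow, Complex.norm_real, Real.norm_eq_abs, sq_abs]
      gcongr
    rw [integral_mul_const] at h2
    have h3 : (2 * Real.pi)⁻¹ ≤ 1 := inv_le_one_of_one_le₀ (by linarith [Real.pi_gt_three])
    have h4 : 0 ≤ ∫ y, ‖V y * φ y‖ ^ 2 ∂circleMeasure := integral_nonneg fun _ => by positivity
    exact (mul_le_of_le_one_left h4 h3).trans h2
  · have hsum := hasSum_integral_of_summable_integral_norm (μ := circleMeasure)
      (F := fun (l : ℤ) (y : ℝ) => (starRingEnd ℂ) (circleCoeff φ l) *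
        (V y * φ y * Complex.exp (-Complex.I * (l * y))))
      (fun l => (integrable_mul_exp hVφ1 l).const_mul _)
      (by
        have : ∀ (l : ℤ) (y : ℝ), ‖(starRingEnd ℂ) (circleCoeff φ l) *
            (V y * φ y * Complex.exp (-Complex.I * (l * y)))‖ =
            ‖circleCoeff φ l‖ * ‖V y * φ y‖ := fun l y => by
          rw [norm_mul, norm_mul (_ * _), norm_exp_neg_I_mul_int, mul_one, RCLike.norm_conj]
        simp only [this, integral_const_mul]
        exact ha.mul_right _)
    have h2 : ∫ y : ℝ, ∑' l : ℤ, (starRingEnd ℂ) (circleCoeff φ l) *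
        (V y * φ y * Complex.exp (-Complex.I * (l * y))) ∂circleMeasure =
        ((∫ y : ℝ, V y * ‖φ y‖ ^ 2 ∂circleMeasure : ℝ) : ℂ) := by
      rw [← integral_complex_ofReal]
      refine integral_congr_ae ?_
      filter_upwards [hinv] with y hy
      have h3 : (starRingEnd ℂ) (φ y) =
          ∑' l : ℤ, (starRingEnd ℂ) (circleCoeff φ l) * Complex.exp (-Complex.I * (l * y)) := by
        conv_lhs => rw [hy]
        rw [Complex.conj_tsum]
        refine tsum_congr fun l => ?_
        rw [map_mul, ← Complex.exp_conj]
        simp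
      have h4 : ∀ l : ℤ, (starRingEnd ℂ) (circleCoeff φ l) *
          (V y * φ y * Complex.exp (-Complex.I * (l * y))) = V y * φ y *
          ((starRingEnd ℂ) (circleCoeff φ l) * Complex.exp (-Complex.I * (l * y))) := fun l => by
        ring
      simp only [h4]
      rw [tsum_mul_left, ← h3, mul_assoc, Complex.mul_conj, Complex.normSq_eq_norm_sq]
      push_cast
      rfl
    have h5 : ∀ l : ℤ, (starRingEnd ℂ) (circleCoeff φ l) * circleCoeff (fun y => V y * φ y) l =
        (1 / (2 * Real.pi) : ℂ) * ∫ y : ℝ, (starRingEnd ℂ) (circleCoeff φ l) *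
        (V y * φ y * Complex.exp (-Complex.I * (l * y))) ∂circleMeasure := fun l => by
      rw [integral_const_mul]
      simp only [circleCoeff]
      ring
    simp only [h5]
    rw [tsum_mul_left, hsum.tsum_eq, h2]
    have : (1 / (2 * Real.pi) : ℂ) = ((1 / (2 * Real.pi) : ℝ) : ℂ) := by push_cast; rfl
    rw [this, ← Complex.ofReal_mul, Complex.ofReal_im]

/-! ### Fourier coefficients on the torus -/

lemma restrict_torusCell :
    (volume : Measure (ℝ × ℝ)).restrict torusCell = circleMeasure.prod circleMeasure := by
  rw [circleMeasure, Measure.prod_restrict]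
  rfl

instance : IsFiniteMeasure ((volume : Measure (ℝ × ℝ)).restrict torusCell) := by
  rw [restrict_torusCell]
  infer_instance

/-- The `k`-th Fourier coefficient of a function on the torus in the variable `x`, as a function
of `y`. -/
noncomputable def partialCoeff (f : ℝ × ℝ → ℝ) (k : ℤ) (y : ℝ) : ℂ :=
  circleCoeff (fun x => (f (x, y) : ℂ)) k

lemma torusFourierCoeff_eq {f : ℝ × ℝ → ℝ} (hf : Integrable f (volume.restrict torusCell))
    (k l : ℤ) : torusFourierCoeff f (k, l) = circleCoeff (partialCoeff f k) l := by
  rw [restrict_torusCell] at hf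
  have hint : Integrable (fun p : ℝ × ℝ => (f p : ℂ) *
      Complex.exp (-Complex.I * (k * p.1 + l * p.2))) (circleMeasure.prod circleMeasure) := by
    refine hf.ofReal.mul_bdd (c := 1) (Continuous.aestronglyMeasurable (by fun_prop))
      (ae_of_all _ fun p => ?_)
    have := norm_exp_neg_I_mul (k * p.1 + l * p.2)
    push_cast at this
    exact this.le
  rw [torusFourierCoeff, restrict_torusCell, integral_prod_symm _ hint, circleCoeff]
  simp only [partialCoeff, circleCoeff]
  have : ∀ y : ℝ, (1 / (2 * Real.pi) : ℂ) * (∫ x : ℝ, (f (x, y) : ℂ) *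
      Complex.exp (-Complex.I * (k * x)) ∂circleMeasure) * Complex.exp (-Complex.I * (l * y)) =
      (1 / (2 * Real.pi) : ℂ) * ∫ x : ℝ, (f (x, y) : ℂ) *
      Complex.exp (-Complex.I * (k * x + l * y)) ∂circleMeasure := fun y => by
    rw [mul_assoc, ← integral_mul_const]
    congr 2
    funext x
    rw [mul_assoc, ← Complex.exp_add]
    congr 2
    ring
  simp only [this]
  rw [integral_const_mul, ← mul_assoc]
  congr 1
  ring

lemma aestronglyMeasurable_partialCoeff {f : ℝ × ℝ → ℝ}
    (hf : AEStronglyMeasurable f (circleMeasure.prod circleMeasure)) (k : ℤ) :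
    AEStronglyMeasurable (partialCoeff f k) circleMeasure := by
  have h1 : AEStronglyMeasurable (fun p : ℝ × ℝ => (f p : ℂ) *
      Complex.exp (-Complex.I * (k * p.1))) (circleMeasure.prod circleMeasure) :=
    (Complex.continuous_ofReal.comp_aestronglyMeasurable hf).mul
      (Continuous.aestronglyMeasurable (by fun_prop))
  exact (h1.prod_swap.integral_prod_right').const_mul _

lemma memLp_section {f : ℝ × ℝ → ℝ} (hf : MemLp f 2 (circleMeasure.prod circleMeasure)) :
    ∀ᵐ y ∂circleMeasure, MemLp (fun x => (f (x, y) : ℂ)) 2 circleMeasure := by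
  have h1 : AEMeasurable (fun p => ‖f p‖ₑ ^ 2) (circleMeasure.prod circleMeasure) :=
    hf.1.enorm.pow_const 2
  have h2 : ∫⁻ y, ∫⁻ x, ‖f (x, y)‖ₑ ^ 2 ∂circleMeasure ∂circleMeasure < ⊤ := by
    rw [← lintegral_prod_symm _ h1, ← sq_eLpNorm_two]
    exact ENNReal.pow_lt_top hf.2
  have h3 := ae_lt_top' (h1.prod_swap.lintegral_prod_right') h2.ne
  filter_upwards [h3, hf.1.prod_swap.prodMk_left] with y hy hm
  have hm' : AEStronglyMeasurable (fun x => f (x, y)) circleMeasure := hm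
  have : MemLp (fun x => f (x, y)) 2 circleMeasure := by
    refine ⟨hm', ?_⟩
    by_contra h
    rw [not_lt, top_le_iff] at h
    have h4 := sq_eLpNorm_two circleMeasure fun x => f (x, y)
    rw [h] at h4
    simp only [Prod.swap_prod_mk] at hy
    rw [← h4] at hy
    simp at hy
  exact this.ofReal

/-- Parseval's identity in the variable `x`, integrated over `y`. -/
lemma tsum_lintegral_partialCoeff {f : ℝ × ℝ → ℝ}
    (hf : MemLp f 2 (circleMeasure.prod circleMeasure)) :
    ∑' k, ∫⁻ y, ‖partialCoeff f k y‖ₑ ^ 2 ∂circleMeasure =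
      ENNReal.ofReal (2 * Real.pi)⁻¹ * ∫⁻ p, ‖f p‖ₑ ^ 2 ∂(circleMeasure.prod circleMeasure) := by
  rw [← lintegral_tsum fun k => (aestronglyMeasurable_partialCoeff hf.1 k).enorm.pow_const 2,
    lintegral_prod_symm _ (hf.1.enorm.pow_const 2), ← lintegral_const_mul'']
  · refine lintegral_congr_ae ?_
    filter_upwards [memLp_section hf] with y hy
    rw [show (∑' k, ‖partialCoeff f k y‖ₑ ^ 2) = _ from tsum_enorm_sq_circleCoeff hy]
    simp only [← ofReal_norm, Complex.norm_real]
  · exact (hf.1.enorm.pow_const 2).prod_swap.lintegral_prod_right'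

lemma memLp_partialCoeff {f : ℝ × ℝ → ℝ}
    (hf : MemLp f 2 (circleMeasure.prod circleMeasure)) (k : ℤ) :
    MemLp (partialCoeff f k) 2 circleMeasure := by
  refine ⟨aestronglyMeasurable_partialCoeff hf.1 k, ?_⟩
  have h1 : ∫⁻ y, ‖partialCoeff f k y‖ₑ ^ 2 ∂circleMeasure < ⊤ := by
    refine (ENNReal.le_tsum (f := fun k => ∫⁻ y, ‖partialCoeff f k y‖ₑ ^ 2 ∂circleMeasure)
      k).trans_lt ?_
    rw [tsum_lintegral_partialCoeff hf, ← sq_eLpNorm_two]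
    exact ENNReal.mul_lt_top ENNReal.ofReal_lt_top (ENNReal.pow_lt_top hf.2)
  rw [← sq_eLpNorm_two] at h1
  exact lt_top_iff_ne_top.2 fun h => by simp [h] at h1

/-- Parseval's identity on the torus. -/
lemma tsum_enorm_sq_torusFourierCoeff {f : ℝ × ℝ → ℝ}
    (hf : MemLp f 2 (volume.restrict torusCell)) :
    ∑' n, ‖torusFourierCoeff f n‖ₑ ^ 2 =
      ENNReal.ofReal ((2 * Real.pi) ^ 2)⁻¹ * normL2 f ^ 2 := by
  have hint : Integrable f (volume.restrict torusCell) := hf.integrable (by norm_num)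
  rw [normL2, sq_eLpNorm_two, restrict_torusCell] at *
  rw [ENNReal.tsum_prod' (f := fun n => ‖torusFourierCoeff f n‖ₑ ^ 2)]
  rw [← restrict_torusCell] at hint
  simp only [torusFourierCoeff_eq hint, tsum_enorm_sq_circleCoeff (memLp_partialCoeff hf _)]
  rw [ENNReal.tsum_mul_left, tsum_lintegral_partialCoeff hf, ← mul_assoc,
    ← ENNReal.ofReal_mul (by positivity), ← mul_inv, sq]

lemma integrable_mul_snd {f : ℝ × ℝ → ℝ} {V : ℝ → ℝ}
    (hf : MemLp f 2 (volume.restrict torusCell)) (hV : MemLp V 2 circleMeasure) :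
    Integrable (fun p => f p * V p.2) (volume.restrict torusCell) := by
  rw [restrict_torusCell] at *
  exact hf.integrable_mul (hV.comp_snd circleMeasure)

lemma torusFourierCoeff_mul_snd {f : ℝ × ℝ → ℝ} {V : ℝ → ℝ}
    (hf : MemLp f 2 (volume.restrict torusCell)) (hV : MemLp V 2 circleMeasure) (k l : ℤ) :
    torusFourierCoeff (fun p => f p * V p.2) (k, l) =
      circleCoeff (fun y => V y * partialCoeff f k y) l := by
  rw [torusFourierCoeff_eq (integrable_mul_snd hf hV)]
  congr 1
  funext y
  simp only [partialCoeff, circleCoeff]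
  rw [mul_left_comm, ← integral_const_mul (V y : ℂ)]
  congr 2
  funext x
  push_cast
  ring

/-! ### Weak derivatives in time -/

lemma absolutelyContinuousOnInterval_congr {f g : ℝ → ℝ} {x y : ℝ}
    (hf : AbsolutelyContinuousOnInterval f x y) (hfg : EqOn f g (uIcc x y)) :
    AbsolutelyContinuousOnInterval g x y := by
  rw [absolutelyContinuousOnInterval_iff] at hf ⊢
  intro ε hε
  obtain ⟨δ, hδ, h⟩ := hf ε hε
  refine ⟨δ, hδ, fun E hE hEδ => ?_⟩
  have h1 := h E hE hEδ
  rwa [Finset.sum_congr rfl fun i hi => by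
    rw [hfg (hE.1 i hi).1, hfg (hE.1 i hi).2]] at h1

/-- A continuous function on `[0, ∞)` whose weak derivative, tested up to the boundary, is the
locally integrable function `h`, is a primitive of `h`. -/
lemma eq_add_integral_of_weak {P h : ℝ → ℝ} (hP : ContinuousOn P (Ici 0))
    (hh : ∀ T ≥ 0, IntervalIntegrable h volume 0 T)
    (hw : ∀ θ : ℝ → ℝ, ContDiff ℝ ∞ θ → (∃ T, ∀ t ≥ T, θ t = 0) →
      (∫ t in Ioi (0 : ℝ), (deriv θ t * P t + θ t * h t)) + P 0 * θ 0 = 0) :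
    ∀ t ≥ 0, P t = P 0 + ∫ τ in (0 : ℝ)..t, h τ := by
  set I : ℝ → ℝ := fun t => ∫ τ in (0 : ℝ)..t, h τ with hI
  have hIac : ∀ T ≥ 0, AbsolutelyContinuousOnInterval I 0 T := fun T hT =>
    (hh T hT).absolutelyContinuousOnInterval_intervalIntegral left_mem_uIcc
  have hIcont : ContinuousOn I (Ici 0) := by
    intro t ht
    have h1 := (hIac (t + 1) (by linarith [mem_Ici.1 ht])).continuousOn
    rw [uIcc_of_le (by linarith [mem_Ici.1 ht])] at h1
    refine (h1 t ⟨ht, by linarith⟩).mono_of_mem_nhdsWithin ?_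
    have : Iio (t + 1) ∈ 𝓝[Ici 0] t := mem_nhdsWithin_of_mem_nhds (Iio_mem_nhds (by linarith))
    filter_upwards [this, self_mem_nhdsWithin] with s hs1 hs2
    exact ⟨hs2, hs1.le⟩
  set b : ℝ → ℝ := fun t => P t - P 0 - I t with hb
  have hbcont : ContinuousOn b (Ici 0) := (hP.sub continuousOn_const).sub hIcont
  have hae : ∀ᵐ t : ℝ, t ∈ Ioi (0 : ℝ) → b t = 0 := by
    refine isOpen_Ioi.ae_eq_zero_of_integral_contDiff_smul_eq_zero
      ((hbcont.mono Ioi_subset_Ici_self).locallyIntegrableOn measurableSet_Ioi) ?_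
    intro ψ hψ hψc hψs
    obtain ⟨R, hR0, hR⟩ : ∃ R > 0, ∀ t ≥ R, ψ t = 0 := by
      obtain ⟨R, hR⟩ := hψc.isCompact.bddAbove
      refine ⟨max R 0 + 1, by positivity, fun t ht => image_eq_zero_of_notMem_tsupport
        fun hmem => ?_⟩
      have := hR hmem
      linarith [le_max_left R 0]
    have hψ0 : ∀ t ≤ 0, ψ t = 0 := fun t ht => image_eq_zero_of_notMem_tsupport
      fun hmem => not_lt.2 ht (hψs hmem)
    -- the test function is the primitive of `ψ` that vanishes for large times
    set θ : ℝ → ℝ := fun t => ∫ τ in R..t, ψ τ with hθ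
    have hθd : ∀ t, HasDerivAt θ (ψ t) t := fun t =>
      intervalIntegral.integral_hasDerivAt_right (hψ.continuous.intervalIntegrable _ _)
        (hψ.continuous.stronglyMeasurableAtFilter _ _) hψ.continuous.continuousAt
    have hθderiv : deriv θ = ψ := funext fun t => (hθd t).deriv
    have hθs : ContDiff ℝ ∞ θ := by
      rw [contDiff_infty_iff_deriv, hθderiv]
      exact ⟨fun t => (hθd t).differentiableAt, hψ⟩
    have hθR : ∀ t ≥ R, θ t = 0 := fun t ht => by
      rw [hθ]
      refine intervalIntegral.integral_zero_ae (ae_of_all _ fun τ hτ => hR τ ?_)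
      rw [uIoc_of_le ht] at hτ
      exact hτ.1.le
    have hw' := hw θ hθs ⟨R, hθR⟩
    have e1 : ∫ t in Ioi (0 : ℝ), (deriv θ t * P t + θ t * h t) =
        ∫ t in (0 : ℝ)..R, (ψ t * P t + θ t * h t) := by
      rw [intervalIntegral.integral_of_le hR0.le, hθderiv]
      refine setIntegral_eq_of_subset_of_forall_sdiff_eq_zero measurableSet_Ioi
        Ioc_subset_Ioi_self fun t ht => ?_
      have : R ≤ t := by
        by_contra h'
        exact ht.2 ⟨ht.1, (not_le.1 h').le⟩
      rw [hR t this, hθR t this]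
      ring
    have e2 : ∫ t, ψ t • b t = ∫ t in (0 : ℝ)..R, ψ t * b t := by
      rw [intervalIntegral.integral_of_le hR0.le]
      symm
      refine setIntegral_eq_integral_of_forall_compl_eq_zero fun t ht => ?_
      rcases le_or_gt t 0 with h' | h'
      · rw [hψ0 t h', zero_mul]
      · rw [hR t (by by_contra h''; exact ht ⟨h', (not_le.1 h'').le⟩), zero_mul]
    have hsub : uIcc 0 R ⊆ Ici 0 := by rw [uIcc_of_le hR0.le]; exact Icc_subset_Ici_self
    have iψP : IntervalIntegrable (fun t => ψ t * P t) volume 0 R :=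
      (hψ.continuous.continuousOn.mul (hP.mono hsub)).intervalIntegrable
    have iψ : IntervalIntegrable (fun t => ψ t * P 0) volume 0 R :=
      (hψ.continuous.mul continuous_const).intervalIntegrable _ _
    have iψI : IntervalIntegrable (fun t => ψ t * I t) volume 0 R :=
      (hψ.continuous.continuousOn.mul (hIcont.mono hsub)).intervalIntegrable
    have iθh : IntervalIntegrable (fun t => θ t * h t) volume 0 R :=
      (hh R hR0.le).continuousOn_mul hθs.continuous.continuousOn
    have e3 : ∫ t in (0 : ℝ)..R, ψ t * b t = (∫ t in (0 : ℝ)..R, ψ t * P t) -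
        (∫ t in (0 : ℝ)..R, ψ t * P 0) - ∫ t in (0 : ℝ)..R, ψ t * I t := by
      rw [← intervalIntegral.integral_sub iψP iψ, ← intervalIntegral.integral_sub (iψP.sub iψ) iψI]
      refine intervalIntegral.integral_congr fun t _ => ?_
      simp only [hb]
      ring
    have e4 : ∫ t in (0 : ℝ)..R, ψ t * P 0 = -θ 0 * P 0 := by
      rw [intervalIntegral.integral_mul_const, hθ, intervalIntegral.integral_symm]
    have e5 : ∫ t in (0 : ℝ)..R, ψ t * I t = -∫ t in (0 : ℝ)..R, θ t * h t := by
      have hθac : AbsolutelyContinuousOnInterval θ 0 R :=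
        (hθs.of_le (by norm_cast)).contDiffOn.absolutelyContinuousOnInterval
      have h1 := hθac.integral_mul_deriv_eq_deriv_mul (hIac R hR0.le)
      have h2 : ∫ t in (0 : ℝ)..R, θ t * deriv I t = ∫ t in (0 : ℝ)..R, θ t * h t := by
        refine intervalIntegral.integral_congr_ae ?_
        filter_upwards [(hh R hR0.le).ae_hasDerivAt_integral] with t ht htm
        rw [(ht (uIoc_subset_uIcc htm) 0 left_mem_uIcc).deriv]
      rw [h2, hθderiv, hθR R le_rfl] at h1
      have h3 : I 0 = 0 := intervalIntegral.integral_same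
      rw [h3] at h1
      linarith
    rw [intervalIntegral.integral_add iψP iθh] at e1
    rw [e2, e3, e4, e5]
    linarith
  have hzero : EqOn b 0 (Ici 0) := by
    refine Measure.eqOn_of_ae_eq (μ := volume) ?_ hbcont continuousOn_const (by simp)
    rw [Measure.restrict_congr_set Ioi_ae_eq_Ici.symm]
    exact (ae_restrict_iff' measurableSet_Ioi).2 hae
  intro t ht
  have h0 : P t - P 0 - I t = 0 := hzero ht
  linarith

lemma ac_of_eq_add_integral {P h : ℝ → ℝ} (hh : ∀ T ≥ 0, IntervalIntegrable h volume 0 T)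
    (hP : ∀ t ≥ 0, P t = P 0 + ∫ τ in (0 : ℝ)..t, h τ) {T : ℝ} (hT : 0 ≤ T) :
    AbsolutelyContinuousOnInterval P 0 T := by
  have h1 := (contDiff_const (n := 1) (c := P 0)).contDiffOn.absolutelyContinuousOnInterval.fun_add
    ((hh T hT).absolutelyContinuousOnInterval_intervalIntegral left_mem_uIcc)
  refine absolutelyContinuousOnInterval_congr h1 fun t ht => ?_
  rw [uIcc_of_le hT] at ht
  exact (hP t ht.1).symm

lemma ae_hasDerivAt_of_eq_add_integral {P h : ℝ → ℝ}
    (hh : ∀ T ≥ 0, IntervalIntegrable h volume 0 T)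
    (hP : ∀ t ≥ 0, P t = P 0 + ∫ τ in (0 : ℝ)..t, h τ) :
    ∀ᵐ t : ℝ, 0 < t → HasDerivAt P (h t) t := by
  have h1 := ae_all_iff.2 fun n : ℕ => (hh n n.cast_nonneg).ae_hasDerivAt_integral
  filter_upwards [h1] with t ht ht0
  obtain ⟨n, hn⟩ := exists_nat_ge t
  have h2 := ht n (by rw [uIcc_of_le n.cast_nonneg]; exact ⟨ht0.le, hn⟩) 0 left_mem_uIcc
  refine (h2.const_add (P 0)).congr_of_eventuallyEq ?_
  filter_upwards [Ioi_mem_nhds ht0] with s hs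
  exact hP s (mem_Ioi.1 hs).le

/-! ### Evolution of the Fourier coefficients of a solution -/

lemma IsShearProfile.exists_bound {U : ℝ → ℝ → ℝ} (hU : IsShearProfile U) :
    ∃ M : ℝ, 0 ≤ M ∧ ∀ᵐ t : ℝ, 0 < t → MemLp (U t) 2 circleMeasure ∧
      ∫ y, U t y ^ 2 ∂circleMeasure ≤ M ^ 2 := by
  set B := essSup (fun t => eLpNorm (U t) 2 (volume.restrict circleCell))
    (volume.restrict (Ioi (0 : ℝ))) with hB
  refine ⟨B.toReal, ENNReal.toReal_nonneg, ?_⟩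
  have h1 : ∀ᵐ t ∂(volume.restrict (Ioi (0 : ℝ))), eLpNorm (U t) 2 circleMeasure ≤ B :=
    ENNReal.ae_le_essSup _
  have h2 := hU.aestronglyMeasurable
  rw [Measure.volume_eq_prod, ← Measure.prod_restrict] at h2
  have h3 := (ae_restrict_iff' measurableSet_Ioi).1 (h1.and h2.prodMk_left)
  filter_upwards [h3] with t ht ht0
  obtain ⟨h4, h5⟩ := ht ht0
  have h6 : MemLp (U t) 2 circleMeasure := ⟨h5, h4.trans_lt hU.essSup_lt_top⟩
  refine ⟨h6, ?_⟩
  have h7 := ofReal_integral_sq h6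
  rw [← sq_eLpNorm_two] at h7
  simp only [Real.norm_eq_abs, sq_abs] at h7
  have h8 : ENNReal.ofReal (∫ y, U t y ^ 2 ∂circleMeasure) ≤ B ^ 2 := by
    rw [h7]; gcongr
  rw [← ENNReal.toReal_pow]
  exact (ENNReal.ofReal_le_iff_le_toReal (ENNReal.pow_lt_top hU.essSup_lt_top).ne).1 h8

lemma IsSolution.continuousOn_integral {U : ℝ → ℝ → ℝ} {ρ : ℝ → ℝ × ℝ → ℝ}
    (hρ : IsSolution U ρ) {χ : ℝ × ℝ → ℝ} (hχ : Continuous χ) (hχ1 : ∀ p, |χ p| ≤ 1) :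
    ContinuousOn (fun t => ∫ p in torusCell, ρ t p * χ p) (Ici 0) := by
  have hint : ∀ t ≥ 0, Integrable (fun p => ρ t p * χ p) (volume.restrict torusCell) :=
    fun t ht => ((hρ.memL2 t ht).integrable (by norm_num)).mul_bdd (c := 1)
      hχ.aestronglyMeasurable (ae_of_all _ hχ1)
  intro t ht
  refine tendsto_integral_of_L1 _ (hint t ht).1 ?_ ?_
  · filter_upwards [self_mem_nhdsWithin] with s hs using hint s hs
  · set c : ℝ≥0∞ := (volume.restrict torusCell) univ ^ ((1 : ℝ) / (1 : ℝ≥0∞).toReal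
      - 1 / (2 : ℝ≥0∞).toReal) with hc
    have hc' : c ≠ ⊤ := by
      refine ENNReal.rpow_ne_top_of_nonneg (by norm_num) (measure_ne_top _ _)
    have h1 := ENNReal.Tendsto.mul_const (hρ.continuous_L2 t ht) (Or.inr hc')
    rw [zero_mul] at h1
    refine tendsto_of_tendsto_of_tendsto_of_le_of_le' tendsto_const_nhds h1
      (Eventually.of_forall fun _ => zero_le) ?_
    filter_upwards [self_mem_nhdsWithin] with s hs
    have h2 := eLpNorm_le_eLpNorm_mul_rpow_measure_univ (p := 1) (q := 2) (by norm_num)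
      ((hρ.memL2 s hs).1.sub (hρ.memL2 t ht).1)
    refine le_trans ?_ h2
    rw [eLpNorm_one_eq_lintegral_enorm]
    refine lintegral_mono fun p => ?_
    rw [← sub_mul, enorm_mul]
    refine mul_le_of_le_one_right' ?_
    rw [← ofReal_norm, ENNReal.ofReal_le_one]
    exact hχ1 p

lemma IsSolution.exists_normL2_le {U : ℝ → ℝ → ℝ} {ρ : ℝ → ℝ × ℝ → ℝ}
    (hρ : IsSolution U ρ) (T : ℝ) :
    ∃ C : ℝ≥0∞, C ≠ ⊤ ∧ ∀ t ∈ Icc 0 T, normL2 (ρ t) ≤ C := by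
  refine (isCompact_Icc (a := (0 : ℝ)) (b := T)).induction_on
    (p := fun s => ∃ C : ℝ≥0∞, C ≠ ⊤ ∧ ∀ t ∈ s, normL2 (ρ t) ≤ C) ⟨0, by simp⟩ ?_ ?_ ?_
  · rintro s t hst ⟨C, hC, h⟩
    exact ⟨C, hC, fun x hx => h x (hst hx)⟩
  · rintro s t ⟨C, hC, h⟩ ⟨D, hD, h'⟩
    refine ⟨C + D, ENNReal.add_ne_top.2 ⟨hC, hD⟩, fun x hx => ?_⟩
    rcases hx with hx | hx
    · exact (h x hx).trans le_self_add
    · exact (h' x hx).trans le_add_self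
  · intro t ht
    have h1 : ∀ᶠ s in 𝓝[Ici 0] t, normL2 (ρ s - ρ t) < 1 :=
      (hρ.continuous_L2 t ht.1).eventually (gt_mem_nhds one_pos)
    refine ⟨{s | 0 ≤ s ∧ normL2 (ρ s - ρ t) < 1}, ?_, normL2 (ρ t) + 1,
      ENNReal.add_ne_top.2 ⟨(hρ.memL2 t ht.1).2.ne, ENNReal.one_ne_top⟩, fun s hs => ?_⟩
    · refine nhdsWithin_mono t Icc_subset_Ici_self ?_
      filter_upwards [h1, self_mem_nhdsWithin] with s hs1 hs2 using ⟨hs2, hs1⟩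
    · have h2 : ρ s = ρ t + (ρ s - ρ t) := by abel
      rw [h2]
      refine (eLpNorm_add_le (hρ.memL2 t ht.1).1
        ((hρ.memL2 s hs.1).1.sub (hρ.memL2 t ht.1).1) (by norm_num)).trans ?_
      exact add_le_add_right hs.2.le _

/-- The transport term, tested against a bounded function, is locally integrable in time. -/
lemma IsSolution.intervalIntegrable_transport {U : ℝ → ℝ → ℝ} {ρ : ℝ → ℝ × ℝ → ℝ}
    (hU : IsShearProfile U) (hρ : IsSolution U ρ) {χ : ℝ × ℝ → ℝ} (hχ : Continuous χ)
    (hχ1 : ∀ p, |χ p| ≤ 1) {T : ℝ} (hT : 0 ≤ T) :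
    IntervalIntegrable (fun t => ∫ p in torusCell, ρ t p * U t p.2 * χ p) volume 0 T := by
  obtain ⟨M, hM0, hM⟩ := hU.exists_bound
  obtain ⟨C, hC, hCρ⟩ := hρ.exists_normL2_le T
  have hmeas : AEStronglyMeasurable (fun t => ∫ p in torusCell, ρ t p * U t p.2 * χ p)
      (volume.restrict (Ioi (0 : ℝ))) := by
    have h1 := hρ.aestronglyMeasurable
    have h2 := hU.aestronglyMeasurable
    rw [Measure.volume_eq_prod, ← Measure.prod_restrict] at h1 h2
    have h3 : AEStronglyMeasurable (fun q : ℝ × (ℝ × ℝ) => U q.1 q.2.2)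
        ((volume.restrict (Ioi (0 : ℝ))).prod (volume.restrict torusCell)) := by
      rw [restrict_torusCell]
      have hq : Measure.QuasiMeasurePreserving (Prod.map (id : ℝ → ℝ) (Prod.snd : ℝ × ℝ → ℝ))
          ((volume.restrict (Ioi (0 : ℝ))).prod (circleMeasure.prod circleMeasure))
          ((volume.restrict (Ioi (0 : ℝ))).prod circleMeasure) :=
        MeasureTheory.QuasiMeasurePreserving.prodMap (Measure.QuasiMeasurePreserving.id _)
          Measure.quasiMeasurePreserving_snd
      exact h2.comp_quasiMeasurePreserving hq
    exact ((h1.mul h3).mul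
      (hχ.comp continuous_snd).aestronglyMeasurable).integral_prod_right'
  rw [intervalIntegrable_iff_integrableOn_Ioc_of_le hT]
  refine Integrable.of_bound (hmeas.mono_measure
    (Measure.restrict_mono Ioc_subset_Ioi_self le_rfl))
    ((C ^ 2).toReal + 2 * Real.pi * M ^ 2) ?_
  rw [ae_restrict_iff' measurableSet_Ioc]
  filter_upwards [hM] with t ht htm
  obtain ⟨hUL, hUM⟩ := ht htm.1
  have hρL := hρ.memL2 t htm.1.le
  have hUL' : MemLp (fun p : ℝ × ℝ => U t p.2) 2 (volume.restrict torusCell) := by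
    rw [restrict_torusCell]
    exact hUL.comp_snd circleMeasure
  have i1 := hρL.integrable_sq
  have i2 := hUL'.integrable_sq
  calc ‖∫ p in torusCell, ρ t p * U t p.2 * χ p‖
      ≤ ∫ p in torusCell, (ρ t p ^ 2 + U t p.2 ^ 2) := by
        refine norm_integral_le_of_norm_le (i1.add i2) (ae_of_all _ fun p => ?_)
        rw [norm_mul, norm_mul, Real.norm_eq_abs, Real.norm_eq_abs, Real.norm_eq_abs]
        have h1 : |ρ t p| * |U t p.2| * |χ p| ≤ |ρ t p| * |U t p.2| :=
          mul_le_of_le_one_right (by positivity) (hχ1 p)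
        nlinarith [sq_nonneg (|ρ t p| - |U t p.2|), sq_abs (ρ t p), sq_abs (U t p.2),
          sq_nonneg (ρ t p), sq_nonneg (U t p.2)]
    _ = (∫ p in torusCell, ρ t p ^ 2) + ∫ p in torusCell, U t p.2 ^ 2 := integral_add i1 i2
    _ ≤ (C ^ 2).toReal + 2 * Real.pi * M ^ 2 := by
        refine add_le_add ?_ ?_
        · have h1 := ofReal_integral_sq hρL
          rw [← sq_eLpNorm_two] at h1
          simp only [Real.norm_eq_abs, sq_abs] at h1
          rw [← ENNReal.ofReal_le_iff_le_toReal (ENNReal.pow_ne_top hC), h1]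
          have h2 : normL2 (ρ t) ≤ C := hCρ t ⟨htm.1.le, htm.2⟩
          exact pow_le_pow_left₀ zero_le h2 2
        · rw [restrict_torusCell, integral_fun_snd (fun y => U t y ^ 2)]
          have : circleMeasure.real univ = 2 * Real.pi := by
            rw [circleMeasure, circleCell, measureReal_restrict_apply_univ, Real.volume_real_Ioc]
            rw [max_eq_left (by linarith [Real.pi_pos])]
            ring
          rw [this, smul_eq_mul]
          exact mul_le_mul_of_nonneg_left hUM (by positivity)

/-! ### Testing the equation with plane waves -/

lemma hasDerivAt_phase_fst (k l δ : ℝ) (p : ℝ × ℝ) :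
    HasDerivAt (fun x => k * x + l * p.2 + δ) k p.1 := by
  simpa using (((hasDerivAt_id p.1).const_mul k).add_const (l * p.2)).add_const δ

lemma hasDerivAt_phase_snd (k l δ : ℝ) (p : ℝ × ℝ) :
    HasDerivAt (fun y => k * p.1 + l * y + δ) l p.2 := by
  simpa using (((hasDerivAt_id p.2).const_mul l).const_add (k * p.1)).add_const δ

lemma dx_cos (c k l δ : ℝ) : dx (fun p => c * Real.cos (k * p.1 + l * p.2 + δ)) =
    fun p => (-(k * c)) * Real.sin (k * p.1 + l * p.2 + δ) := by
  funext p
  rw [dx, ((hasDerivAt_phase_fst k l δ p).cos.const_mul c).deriv]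
  ring

lemma dx_sin (c k l δ : ℝ) : dx (fun p => c * Real.sin (k * p.1 + l * p.2 + δ)) =
    fun p => (k * c) * Real.cos (k * p.1 + l * p.2 + δ) := by
  funext p
  rw [dx, ((hasDerivAt_phase_fst k l δ p).sin.const_mul c).deriv]
  ring

lemma dy_cos (c k l δ : ℝ) : dy (fun p => c * Real.cos (k * p.1 + l * p.2 + δ)) =
    fun p => (-(l * c)) * Real.sin (k * p.1 + l * p.2 + δ) := by
  funext p
  rw [dy, ((hasDerivAt_phase_snd k l δ p).cos.const_mul c).deriv]
  ring

lemma dy_sin (c k l δ : ℝ) : dy (fun p => c * Real.sin (k * p.1 + l * p.2 + δ)) =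
    fun p => (l * c) * Real.cos (k * p.1 + l * p.2 + δ) := by
  funext p
  rw [dy, ((hasDerivAt_phase_snd k l δ p).sin.const_mul c).deriv]
  ring

lemma laplacian_cos (c k l δ : ℝ) (p : ℝ × ℝ) :
    laplacian (fun p => c * Real.cos (k * p.1 + l * p.2 + δ)) p =
      -(k ^ 2 + l ^ 2) * c * Real.cos (k * p.1 + l * p.2 + δ) := by
  rw [laplacian, dx_cos, dy_cos, dx_sin, dy_sin]
  ring

lemma isTestFunction_mul_cos {θ : ℝ → ℝ} (hθ : ContDiff ℝ ∞ θ) (hθ0 : ∃ T, ∀ t ≥ T, θ t = 0)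
    (k l : ℤ) (δ : ℝ) :
    IsTestFunction fun t p => θ t * Real.cos (k * p.1 + l * p.2 + δ) where
  smooth := (hθ.comp contDiff_fst).mul (Real.contDiff_cos.comp (by fun_prop))
  periodic t := by
    constructor
    · intro x y
      dsimp only
      rw [← Real.cos_add_int_mul_two_pi (k * x + l * y + δ) k]
      ring_nf
    · intro x y
      dsimp only
      rw [← Real.cos_add_int_mul_two_pi (k * x + l * y + δ) l]
      ring_nf
  eventually_zero := by
    obtain ⟨T, hT⟩ := hθ0
    exact ⟨T, fun t ht p => by rw [hT t ht, zero_mul]⟩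

/-- The equation for one real Fourier coefficient of a solution, in weak form. -/
lemma IsSolution.weak_cos {U : ℝ → ℝ → ℝ} {ρ : ℝ → ℝ × ℝ → ℝ}
    (hU : IsShearProfile U) (hρ : IsSolution U ρ) (k l : ℤ) (δ : ℝ) {θ : ℝ → ℝ}
    (hθ : ContDiff ℝ ∞ θ) (hθ0 : ∃ T, ∀ t ≥ T, θ t = 0) :
    (∫ t in Ioi (0 : ℝ),
      (deriv θ t * (∫ p in torusCell, ρ t p * Real.cos (k * p.1 + l * p.2 + δ)) +
      θ t * (-k * (∫ p in torusCell, ρ t p * U t p.2 * Real.sin (k * p.1 + l * p.2 + δ))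
        - ((k : ℝ) ^ 2 + (l : ℝ) ^ 2) *
          ∫ p in torusCell, ρ t p * Real.cos (k * p.1 + l * p.2 + δ))))
      + (∫ p in torusCell, ρ 0 p * Real.cos (k * p.1 + l * p.2 + δ)) * θ 0 = 0 := by
  obtain ⟨M, -, hM⟩ := hU.exists_bound
  have h := hρ.equation _ (isTestFunction_mul_cos hθ hθ0 k l δ)
  refine Eq.trans ?_ h
  congr 1
  · refine setIntegral_congr_ae measurableSet_Ioi ?_
    filter_upwards [hM] with t ht ht0
    have i1 : Integrable (fun p : ℝ × ℝ => ρ t p * Real.cos (k * p.1 + l * p.2 + δ))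
        (volume.restrict torusCell) :=
      ((hρ.memL2 t (mem_Ioi.1 ht0).le).integrable one_le_two).mul_bdd (c := 1)
        (Continuous.aestronglyMeasurable (by fun_prop)) (ae_of_all _ fun _ => Real.abs_cos_le_one _)
    have i2 : Integrable (fun p : ℝ × ℝ => ρ t p * U t p.2 * Real.sin (k * p.1 + l * p.2 + δ))
        (volume.restrict torusCell) :=
      (integrable_mul_snd (hρ.memL2 t (mem_Ioi.1 ht0).le) (ht ht0).1).mul_bdd (c := 1)
        (Continuous.aestronglyMeasurable (by fun_prop)) (ae_of_all _ fun _ => Real.abs_sin_le_one _)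
    have e : ∀ p : ℝ × ℝ, ρ t p *
        (dt (fun t p => θ t * Real.cos (k * p.1 + l * p.2 + δ)) t p +
          U t p.2 * dx (fun p => θ t * Real.cos (k * p.1 + l * p.2 + δ)) p +
          laplacian (fun p => θ t * Real.cos (k * p.1 + l * p.2 + δ)) p) =
        (deriv θ t - θ t * ((k : ℝ) ^ 2 + (l : ℝ) ^ 2)) *
          (ρ t p * Real.cos (k * p.1 + l * p.2 + δ)) +
        (-(k * θ t)) * (ρ t p * U t p.2 * Real.sin (k * p.1 + l * p.2 + δ)) := fun p => by
      have hdt : dt (fun t p => θ t * Real.cos (k * p.1 + l * p.2 + δ)) t p =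
          deriv θ t * Real.cos (k * p.1 + l * p.2 + δ) := by
        rw [dt, deriv_mul_const_field]
      rw [hdt, dx_cos, laplacian_cos]
      ring
    simp only [e]
    rw [integral_add (i1.const_mul _) (i2.const_mul _), integral_const_mul, integral_const_mul]
    ring
  · rw [← integral_mul_const]
    exact integral_congr_ae (ae_of_all _ fun p => by ring)

/-- Each real Fourier coefficient of a solution is absolutely continuous in time and solves its
ordinary differential equation almost everywhere. -/
lemma IsSolution.coefficient_evolution {U : ℝ → ℝ → ℝ} {ρ : ℝ → ℝ × ℝ → ℝ}
    (hU : IsShearProfile U) (hρ : IsSolution U ρ) (k l : ℤ) (δ : ℝ) :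
    (∀ T ≥ 0, AbsolutelyContinuousOnInterval
      (fun t => ∫ p in torusCell, ρ t p * Real.cos (k * p.1 + l * p.2 + δ)) 0 T) ∧
    ∀ᵐ t : ℝ, 0 < t → HasDerivAt
      (fun t => ∫ p in torusCell, ρ t p * Real.cos (k * p.1 + l * p.2 + δ))
      (-k * (∫ p in torusCell, ρ t p * U t p.2 * Real.sin (k * p.1 + l * p.2 + δ))
        - ((k : ℝ) ^ 2 + (l : ℝ) ^ 2) *
          ∫ p in torusCell, ρ t p * Real.cos (k * p.1 + l * p.2 + δ)) t := by
  have hP := hρ.continuousOn_integral (χ := fun p => Real.cos (k * p.1 + l * p.2 + δ))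
    (by fun_prop) fun p => Real.abs_cos_le_one _
  have hh : ∀ T ≥ 0, IntervalIntegrable (fun t =>
      (-k * (∫ p in torusCell, ρ t p * U t p.2 * Real.sin (k * p.1 + l * p.2 + δ))
        - ((k : ℝ) ^ 2 + (l : ℝ) ^ 2) *
          ∫ p in torusCell, ρ t p * Real.cos (k * p.1 + l * p.2 + δ))) volume 0 T := by
    intro T hT
    refine ((hρ.intervalIntegrable_transport hU
      (χ := fun p => Real.sin (k * p.1 + l * p.2 + δ)) (by fun_prop)
      (fun p => Real.abs_sin_le_one _) hT).const_mul _).sub (IntervalIntegrable.const_mul ?_ _)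
    refine (hP.mono ?_).intervalIntegrable
    rw [uIcc_of_le hT]
    exact Icc_subset_Ici_self
  have key := eq_add_integral_of_weak hP hh fun θ hθ hθ0 => hρ.weak_cos hU k l δ hθ hθ0
  exact ⟨fun T hT => ac_of_eq_add_integral hh key hT, ae_hasDerivAt_of_eq_add_integral hh key⟩

lemma integrable_torus_mul_exp {f : ℝ × ℝ → ℝ} (hf : Integrable f (volume.restrict torusCell))
    (k l : ℤ) : Integrable (fun p : ℝ × ℝ =>
      (f p : ℂ) * Complex.exp (-Complex.I * (k * p.1 + l * p.2))) (volume.restrict torusCell) := by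
  refine hf.ofReal.mul_bdd (c := 1) (Continuous.aestronglyMeasurable (by fun_prop))
    (ae_of_all _ fun p => ?_)
  have := norm_exp_neg_I_mul (k * p.1 + l * p.2)
  push_cast at this
  exact this.le

lemma exp_neg_I_mul_phase (k l : ℤ) (p : ℝ × ℝ) :
    Complex.exp (-Complex.I * (k * p.1 + l * p.2)) =
      (Real.cos (k * p.1 + l * p.2) : ℂ) - Real.sin (k * p.1 + l * p.2) * Complex.I := by
  rw [neg_mul, mul_comm, ← neg_mul, Complex.exp_mul_I, Complex.cos_neg, Complex.sin_neg,
    Complex.ofReal_cos, Complex.ofReal_sin]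
  push_cast
  ring

lemma re_torusFourierCoeff {f : ℝ × ℝ → ℝ} (hf : Integrable f (volume.restrict torusCell))
    (k l : ℤ) : (torusFourierCoeff f (k, l)).re =
      ((2 * Real.pi) ^ 2)⁻¹ * ∫ p in torusCell, f p * Real.cos (k * p.1 + l * p.2) := by
  have h1 : (1 / (2 * Real.pi) ^ 2 : ℂ) = ((((2 * Real.pi) ^ 2)⁻¹ : ℝ) : ℂ) := by
    push_cast; rw [one_div]
  rw [torusFourierCoeff, h1, Complex.re_ofReal_mul]
  congr 1
  rw [← RCLike.re_eq_complex_re, ← integral_re (integrable_torus_mul_exp hf k l)]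
  refine integral_congr_ae (ae_of_all _ fun p => ?_)
  simp only [RCLike.re_eq_complex_re, Complex.re_ofReal_mul, exp_neg_I_mul_phase]
  simp [-Complex.ofReal_cos, -Complex.ofReal_sin]

lemma im_torusFourierCoeff {f : ℝ × ℝ → ℝ} (hf : Integrable f (volume.restrict torusCell))
    (k l : ℤ) : (torusFourierCoeff f (k, l)).im =
      -(((2 * Real.pi) ^ 2)⁻¹ * ∫ p in torusCell, f p * Real.sin (k * p.1 + l * p.2)) := by
  have h1 : (1 / (2 * Real.pi) ^ 2 : ℂ) = ((((2 * Real.pi) ^ 2)⁻¹ : ℝ) : ℂ) := by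
    push_cast; rw [one_div]
  rw [torusFourierCoeff, h1, Complex.im_ofReal_mul, ← mul_neg, ← integral_neg]
  congr 1
  rw [← RCLike.im_eq_complex_im, ← integral_im (integrable_torus_mul_exp hf k l)]
  refine integral_congr_ae (ae_of_all _ fun p => ?_)
  simp only [RCLike.im_eq_complex_im, Complex.im_ofReal_mul, exp_neg_I_mul_phase]
  simp [-Complex.ofReal_cos, -Complex.ofReal_sin]

lemma sobolevNorm_sq (s : ℝ) (f : ℝ × ℝ → ℝ) : sobolevNorm s f ^ 2 =
    ∑' n : ℤ × ℤ, ENNReal.ofReal ((2 * Real.pi) ^ 2 * (1 + (n.1 : ℝ) ^ 2 + (n.2 : ℝ) ^ 2) ^ s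
      * ‖torusFourierCoeff f n‖ ^ 2) := by
  rw [sobolevNorm, ← ENNReal.rpow_natCast, ← ENNReal.rpow_mul]
  norm_num

lemma tsum_mode_H1_le (f : ℝ × ℝ → ℝ) (k : ℤ) :
    ∑' l : ℤ, ENNReal.ofReal ((1 + (l : ℝ) ^ 2) * ‖torusFourierCoeff f (k, l)‖ ^ 2) ≤
      sobolevNorm 1 f ^ 2 := by
  rw [sobolevNorm_sq]
  refine le_trans (ENNReal.tsum_le_tsum fun l => ?_) (ENNReal.tsum_comp_le_tsum_of_injective
    (f := fun l : ℤ => (k, l)) (fun a b h => (Prod.mk.inj h).2) _)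
  refine ENNReal.ofReal_le_ofReal ?_
  rw [Real.rpow_one]
  gcongr
  have h1 : 1 ≤ (2 * Real.pi) ^ 2 := one_le_pow₀ (by linarith [Real.pi_gt_three])
  have h2 : 0 ≤ 1 + (k : ℝ) ^ 2 + (l : ℝ) ^ 2 := by positivity
  nlinarith [sq_nonneg (k : ℝ)]

lemma IsSolution.summable_sq {U : ℝ → ℝ → ℝ} {ρ : ℝ → ℝ × ℝ → ℝ} (hρ : IsSolution U ρ) {t : ℝ}
    (ht : 0 ≤ t) : Summable fun n => ‖torusFourierCoeff (ρ t) n‖ ^ 2 := by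
  have h1 : ∑' n, ‖torusFourierCoeff (ρ t) n‖ₑ ^ 2 ≠ ⊤ := by
    rw [tsum_enorm_sq_torusFourierCoeff (hρ.memL2 t ht)]
    exact ENNReal.mul_ne_top ENNReal.ofReal_ne_top (ENNReal.pow_ne_top (hρ.memL2 t ht).2.ne)
  simpa using ENNReal.summable_toReal h1

/-- The Fourier modes of a solution in `x` evolve independently, each as a `ShearMode`, with one
constant `M` for all of them. -/
lemma IsSolution.exists_shearMode {U : ℝ → ℝ → ℝ} {ρ : ℝ → ℝ × ℝ → ℝ}
    (hU : IsShearProfile U) (hρ : IsSolution U ρ) :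
    ∃ M : ℝ, ∀ k : ℤ, ShearMode k M (fun t l => torusFourierCoeff (ρ t) (k, l))
      (fun t l => torusFourierCoeff (fun p => ρ t p * U t p.2) (k, l)) := by
  obtain ⟨M, hM0, hM⟩ := hU.exists_bound
  refine ⟨M, fun k => ?_⟩
  have hint : ∀ t ≥ 0, Integrable (ρ t) (volume.restrict torusCell) :=
    fun t ht => (hρ.memL2 t ht).integrable one_le_two
  have hre : ∀ l : ℤ, ∀ t ≥ 0, (torusFourierCoeff (ρ t) (k, l)).re = ((2 * Real.pi) ^ 2)⁻¹ *
      ∫ p in torusCell, ρ t p * Real.cos (k * p.1 + l * p.2 + 0) := fun l t ht => by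
    simp only [add_zero]
    exact re_torusFourierCoeff (hint t ht) k l
  have him : ∀ l : ℤ, ∀ t ≥ 0, (torusFourierCoeff (ρ t) (k, l)).im = ((2 * Real.pi) ^ 2)⁻¹ *
      ∫ p in torusCell, ρ t p * Real.cos (k * p.1 + l * p.2 + Real.pi / 2) := fun l t ht => by
    simp only [Real.cos_add_pi_div_two, mul_neg, integral_neg]
    exact im_torusFourierCoeff (hint t ht) k l
  have hacr : ∀ l : ℤ, ∀ T ≥ 0, AbsolutelyContinuousOnInterval
      (fun t => (torusFourierCoeff (ρ t) (k, l)).re) 0 T := fun l T hT => by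
    refine absolutelyContinuousOnInterval_congr
      (((hρ.coefficient_evolution hU k l 0).1 T hT).const_mul
        (((2 * Real.pi) ^ 2)⁻¹)) fun t ht => ?_
    rw [uIcc_of_le hT] at ht
    exact (hre l t ht.1).symm
  have haci : ∀ l : ℤ, ∀ T ≥ 0, AbsolutelyContinuousOnInterval
      (fun t => (torusFourierCoeff (ρ t) (k, l)).im) 0 T := fun l T hT => by
    refine absolutelyContinuousOnInterval_congr
      (((hρ.coefficient_evolution hU k l (Real.pi / 2)).1 T hT).const_mul
        (((2 * Real.pi) ^ 2)⁻¹)) fun t ht => ?_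
    rw [uIcc_of_le hT] at ht
    exact (him l t ht.1).symm
  have hmeas : ∀ T ≥ 0, AEMeasurable (fun t => ∑' l : ℤ,
      ENNReal.ofReal ((1 + (l : ℝ) ^ 2) * ‖torusFourierCoeff (ρ t) (k, l)‖ ^ 2))
      (volume.restrict (Ioc 0 T)) := fun T hT => by
    refine AEMeasurable.tsum fun l => AEMeasurable.ennreal_ofReal ?_
    refine (ContinuousOn.aemeasurable ?_ measurableSet_Ioc).const_mul _
    simp only [Complex.sq_norm, Complex.normSq_apply]
    have h1 := (hacr l T hT).continuousOn
    have h2 := (haci l T hT).continuousOn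
    rw [uIcc_of_le hT] at h1 h2
    exact ((h1.mul h1).add (h2.mul h2)).mono Ioc_subset_Icc_self
  have hfin : ∀ T > 0, ∫⁻ t in Ioc 0 T, ∑' l : ℤ,
      ENNReal.ofReal ((1 + (l : ℝ) ^ 2) * ‖torusFourierCoeff (ρ t) (k, l)‖ ^ 2) < ⊤ :=
    fun T hT => (lintegral_mono fun t => tsum_mode_H1_le (ρ t) k).trans_lt (hρ.memL2H1 T hT)
  refine ⟨hM0, hacr, haci, fun l => ?_, fun t ht => ?_, ?_, fun T hT => ?_, ?_, ?_⟩
  · filter_upwards [(hρ.coefficient_evolution hU k l 0).2,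
      (hρ.coefficient_evolution hU k l (Real.pi / 2)).2, hM] with t h1 h2 h3 ht
    have hg := integrable_mul_snd (hρ.memL2 t ht.le) (h3 ht).1
    have d1 := (h1 ht).const_mul (((2 * Real.pi) ^ 2)⁻¹)
    have d2 := (h2 ht).const_mul (((2 * Real.pi) ^ 2)⁻¹)
    have d3 := d1.ofReal_comp.add (d2.ofReal_comp.mul_const Complex.I)
    refine (d3.congr_of_eventuallyEq ?_).congr_deriv ?_
    · filter_upwards [Ioi_mem_nhds ht] with s hs
      rw [← Complex.re_add_im (torusFourierCoeff (ρ s) (k, l)), hre l s (mem_Ioi.1 hs).le,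
        him l s (mem_Ioi.1 hs).le]
      rfl
    · have gre := re_torusFourierCoeff hg k l
      have gim := im_torusFourierCoeff hg k l
      have are := hre l t ht.le
      have aim := him l t ht.le
      simp only [add_zero, Real.sin_add_pi_div_two] at are gre gim ⊢
      rw [mul_sub, mul_sub, mul_left_comm _ (-(k : ℝ)), mul_left_comm _ (-(k : ℝ)),
        mul_left_comm _ ((k : ℝ) ^ 2 + (l : ℝ) ^ 2), mul_left_comm _ ((k : ℝ) ^ 2 + (l : ℝ) ^ 2),
        ← are, ← aim, ← gre, show ((2 * Real.pi) ^ 2)⁻¹ * (∫ p in torusCell,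
          ρ t p * U t p.2 * Real.sin (k * p.1 + l * p.2)) =
          -(torusFourierCoeff (fun p => ρ t p * U t p.2) (k, l)).im by rw [gim, neg_neg]]
      refine Complex.ext ?_ ?_
      · simp [-Complex.ofReal_add, -Complex.ofReal_pow, mul_assoc]
        ring
      · simp [-Complex.ofReal_add, -Complex.ofReal_pow, mul_assoc]
        ring
  · exact (hρ.summable_sq ht).comp_injective (i := fun l : ℤ => (k, l))
      fun a b h => (Prod.mk.inj h).2
  · have h1 : ∀ᵐ t : ℝ, ∀ n : ℕ, t ∈ Ioc (0 : ℝ) (n + 1) → ∑' l : ℤ,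
        ENNReal.ofReal ((1 + (l : ℝ) ^ 2) * ‖torusFourierCoeff (ρ t) (k, l)‖ ^ 2) < ⊤ :=
      ae_all_iff.2 fun n => (ae_restrict_iff' measurableSet_Ioc).1
        (ae_lt_top' (hmeas _ (by positivity)) (hfin _ (by positivity)).ne)
    filter_upwards [h1] with t ht ht0
    obtain ⟨n, hn⟩ := exists_nat_ge t
    have h2 := ENNReal.summable_toReal (ht n ⟨ht0, by linarith⟩).ne
    refine h2.congr fun l => ?_
    rw [ENNReal.toReal_ofReal (by positivity)]
  · rcases hT.eq_or_lt with rfl | hT'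
    · simp
    have h1 := integrable_toReal_of_lintegral_ne_top (hmeas T hT) (hfin T hT').ne
    refine h1.congr (ae_of_all _ fun t => ?_)
    dsimp only
    rw [ENNReal.tsum_toReal_eq fun _ => ENNReal.ofReal_ne_top, sqH1]
    exact tsum_congr fun l => ENNReal.toReal_ofReal (by positivity)
  · filter_upwards [hM] with t h1 ht hs s
    have hρt := hρ.memL2 t ht.le
    simp only [torusFourierCoeff_mul_snd hρt (h1 ht).1, torusFourierCoeff_eq (hint t ht.le)]
      at hs ⊢
    rw [restrict_torusCell] at hρt
    refine ((circleCoeff_mul_real (memLp_partialCoeff hρt k) (h1 ht).1 hs).1 s).trans ?_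
    exact mul_le_mul_of_nonneg_right (h1 ht).2 (sq_nonneg _)
  · filter_upwards [hM] with t h1 ht hs
    have hρt := hρ.memL2 t ht.le
    simp only [torusFourierCoeff_mul_snd hρt (h1 ht).1, torusFourierCoeff_eq (hint t ht.le)]
      at hs ⊢
    rw [restrict_torusCell] at hρt
    exact (circleCoeff_mul_real (memLp_partialCoeff hρt k) (h1 ht).1 hs).2

/-! ### Lower bounds for a single mode -/

/-- A mode with finite `H¹` norm that does not vanish at time `t₀` decays at most exponentially. -/
lemma ShearMode.exists_exp_le {k M : ℝ} {a g : ℝ → ℤ → ℂ} (h : ShearMode k M a g)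
    {t₀ : ℝ} (ht₀ : 0 ≤ t₀) (hs : Summable fun l : ℤ => (l : ℝ) ^ 2 * ‖a t₀ l‖ ^ 2)
    (hpos : 0 < ∑' l, ‖a t₀ l‖ ^ 2) :
    ∃ c > 0, ∃ κ, ∀ t ≥ t₀, c * Real.exp (-(κ * t)) ≤ ∑' l, ‖a t l‖ ^ 2 := by
  set E₀ := ∑' l, ‖a t₀ l‖ ^ 2
  set D₀ := ∑' l : ℤ, (l : ℝ) ^ 2 * ‖a t₀ l‖ ^ 2
  obtain ⟨m, hm, hL, hgap⟩ := exists_gap k M ((D₀ + 1) / E₀)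
  rw [div_le_iff₀ hpos] at hL
  have hμ : 0 < (m : ℝ) ^ 2 + m := by positivity
  refine ⟨((m : ℝ) ^ 2 + m)⁻¹, inv_pos.2 hμ, 2 * ((m : ℝ) ^ 2 + m + k ^ 2), fun t ht => ?_⟩
  have h1 := (h.barrier hm hgap ht₀ ht hs).2
  set c := (m : ℝ) ^ 2 + m + k ^ 2
  have hc : 0 ≤ c := by positivity
  have h2 : Real.exp (2 * c * t₀) * (D₀ - ((m : ℝ) ^ 2 + m) * E₀) ≤ -1 := by
    have h3 : 1 ≤ Real.exp (2 * c * t₀) := Real.one_le_exp (by positivity)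
    nlinarith
  have h4 : 0 ≤ ∑' l : ℤ, (l : ℝ) ^ 2 * ‖a t l‖ ^ 2 := tsum_nonneg fun _ => by positivity
  have h5 : 0 < Real.exp (2 * c * t) := Real.exp_pos _
  rw [Real.exp_neg, ← mul_inv, inv_le_iff_one_le_mul₀ (by positivity)]
  nlinarith [mul_nonneg h5.le h4]

/-- The Dirichlet quotient of each mode stays bounded, hence its `H⁻¹` norm stays comparable to its
`L²` norm. -/
lemma ShearMode.exists_le_mul {k M : ℝ} {a g : ℝ → ℤ → ℂ} (h : ShearMode k M a g)
    {t₀ : ℝ} (ht₀ : 0 ≤ t₀) (hs : Summable fun l : ℤ => (l : ℝ) ^ 2 * ‖a t₀ l‖ ^ 2) :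
    ∃ B > 0, ∀ t ≥ t₀, ∑' l, ‖a t l‖ ^ 2 ≤
      B * ∑' l : ℤ, (1 + k ^ 2 + (l : ℝ) ^ 2)⁻¹ * ‖a t l‖ ^ 2 := by
  set E₀ := ∑' l, ‖a t₀ l‖ ^ 2 with hE₀
  set D₀ := ∑' l : ℤ, (l : ℝ) ^ 2 * ‖a t₀ l‖ ^ 2 with hD₀
  obtain ⟨m, hm, hL, hgap⟩ := exists_gap k M (D₀ / E₀)
  set μ : ℝ := (m : ℝ) ^ 2 + m with hμ
  have hμ0 : 0 ≤ μ := by positivity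
  have hq : D₀ - μ * E₀ ≤ 0 := by
    rcases (tsum_nonneg fun l => sq_nonneg ‖a t₀ l‖ : 0 ≤ E₀).eq_or_lt with h0 | h0
    · have h1 := (hasSum_zero_iff_of_nonneg (fun l => sq_nonneg ‖a t₀ l‖)).1
        (by rw [h0]; exact (h.summable_sq t₀ ht₀).hasSum)
      have h2 : D₀ = 0 := by
        rw [hD₀]
        simp only [fun l => show ‖a t₀ l‖ ^ 2 = 0 from congrFun h1 l, mul_zero, tsum_zero]
      rw [h2, show E₀ = 0 from h0.symm]
      simp
    · rw [div_le_iff₀ h0] at hL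
      linarith
  have hB : 0 < 1 + k ^ 2 + μ := by positivity
  refine ⟨1 + k ^ 2 + μ, hB, fun t ht => ?_⟩
  obtain ⟨hst, h1⟩ := h.barrier hm hgap ht₀ ht hs
  have h2 := h1.trans (mul_nonpos_of_nonneg_of_nonpos (Real.exp_pos _).le hq)
  have h3 : ∑' l : ℤ, (l : ℝ) ^ 2 * ‖a t l‖ ^ 2 ≤ μ * ∑' l, ‖a t l‖ ^ 2 := by
    have := nonpos_of_mul_nonpos_right h2 (Real.exp_pos _)
    linarith
  have hsq := h.summable_sq t (ht₀.trans ht)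
  set B := 1 + k ^ 2 + μ with hBdef
  -- the tangent line inequality `2 / B - x / B² ≤ 1 / x`
  have hpt : ∀ l : ℤ, (2 * B - (1 + k ^ 2)) * ‖a t l‖ ^ 2 - (l : ℝ) ^ 2 * ‖a t l‖ ^ 2 ≤
      B ^ 2 * ((1 + k ^ 2 + (l : ℝ) ^ 2)⁻¹ * ‖a t l‖ ^ 2) := fun l => by
    have hx : 0 < 1 + k ^ 2 + (l : ℝ) ^ 2 := by positivity
    have h4 : 2 * B - (1 + k ^ 2) - (l : ℝ) ^ 2 ≤ B ^ 2 * (1 + k ^ 2 + (l : ℝ) ^ 2)⁻¹ := by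
      rw [← div_eq_mul_inv, le_div_iff₀ hx]
      nlinarith [sq_nonneg (B - (1 + k ^ 2 + (l : ℝ) ^ 2))]
    have := mul_le_mul_of_nonneg_right h4 (sq_nonneg ‖a t l‖)
    linarith
  have hsm : Summable fun l : ℤ => (1 + k ^ 2 + (l : ℝ) ^ 2)⁻¹ * ‖a t l‖ ^ 2 := by
    refine Summable.of_nonneg_of_le (fun l => by positivity) (fun l => ?_) hsq
    refine mul_le_of_le_one_left (sq_nonneg _) (inv_le_one_of_one_le₀ ?_)
    nlinarith [sq_nonneg k, sq_nonneg (l : ℝ)]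
  have h5 := hasSum_le hpt ((hsq.hasSum.mul_left (2 * B - (1 + k ^ 2))).sub hst.hasSum)
    (hsm.hasSum.mul_left (B ^ 2))
  have h6 : B * ∑' l, ‖a t l‖ ^ 2 ≤
      B * (B * ∑' l : ℤ, (1 + k ^ 2 + (l : ℝ) ^ 2)⁻¹ * ‖a t l‖ ^ 2) := by
    calc B * ∑' l, ‖a t l‖ ^ 2
        = (2 * B - (1 + k ^ 2)) * ∑' l, ‖a t l‖ ^ 2 - μ * ∑' l, ‖a t l‖ ^ 2 := by
          rw [hBdef]; ring
      _ ≤ B ^ 2 * ∑' l : ℤ, (1 + k ^ 2 + (l : ℝ) ^ 2)⁻¹ * ‖a t l‖ ^ 2 := by linarith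
      _ = _ := by ring
  exact le_of_mul_le_mul_left h6 hB

/-! ### Norms in terms of Fourier coefficients -/

lemma normL2_sq {f : ℝ × ℝ → ℝ} (hf : MemLp f 2 (volume.restrict torusCell))
    (hs : Summable fun n => ‖torusFourierCoeff f n‖ ^ 2) :
    normL2 f ^ 2 = ENNReal.ofReal ((2 * Real.pi) ^ 2 * ∑' n, ‖torusFourierCoeff f n‖ ^ 2) := by
  have h := tsum_enorm_sq_torusFourierCoeff hf
  have h1 : ∑' n, ‖torusFourierCoeff f n‖ₑ ^ 2 =
      ENNReal.ofReal (∑' n, ‖torusFourierCoeff f n‖ ^ 2) := by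
    rw [ENNReal.ofReal_tsum_of_nonneg (fun _ => by positivity) hs]
    refine tsum_congr fun n => ?_
    rw [ENNReal.ofReal_pow (norm_nonneg _), ofReal_norm]
  rw [ENNReal.ofReal_mul (by positivity), ← h1, h, ← mul_assoc,
    ← ENNReal.ofReal_mul (by positivity), mul_inv_cancel₀ (by positivity), ENNReal.ofReal_one,
    one_mul]

lemma summable_negSobolev {f : ℝ × ℝ → ℝ}
    (hs : Summable fun n => ‖torusFourierCoeff f n‖ ^ 2) :
    Summable fun n : ℤ × ℤ =>
      (1 + (n.1 : ℝ) ^ 2 + (n.2 : ℝ) ^ 2)⁻¹ * ‖torusFourierCoeff f n‖ ^ 2 := by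
  refine Summable.of_nonneg_of_le (fun n => by positivity) (fun n => ?_) hs
  refine mul_le_of_le_one_left (sq_nonneg _) (inv_le_one_of_one_le₀ ?_)
  nlinarith [sq_nonneg (n.1 : ℝ), sq_nonneg (n.2 : ℝ)]

lemma sobolevNorm_neg_one_sq {f : ℝ × ℝ → ℝ}
    (hs : Summable fun n => ‖torusFourierCoeff f n‖ ^ 2) :
    sobolevNorm (-1) f ^ 2 = ENNReal.ofReal ((2 * Real.pi) ^ 2 * ∑' n : ℤ × ℤ,
      (1 + (n.1 : ℝ) ^ 2 + (n.2 : ℝ) ^ 2)⁻¹ * ‖torusFourierCoeff f n‖ ^ 2) := by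
  rw [sobolevNorm_sq, ← tsum_mul_left, ENNReal.ofReal_tsum_of_nonneg (fun _ => by positivity)
    ((summable_negSobolev hs).mul_left _)]
  refine tsum_congr fun n => ?_
  rw [Real.rpow_neg_one, mul_assoc]

/-! ### Low modes dominate -/

/-- There are arbitrarily small times at which a given nonzero initial Fourier coefficient is still
nonzero and all modes have finite `H¹` norm. -/
lemma exists_small_time {M : ℝ} {a g : ℤ → ℝ → ℤ → ℂ} (h : ∀ k : ℤ, ShearMode k M (a k) (g k))
    {k l : ℤ} (hkl : a k 0 l ≠ 0) {η : ℝ} (hη : 0 < η) :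
    ∃ t₀, 0 < t₀ ∧ t₀ < η ∧ a k t₀ l ≠ 0 ∧
      ∀ K : ℤ, Summable fun j : ℤ => (j : ℝ) ^ 2 * ‖a K t₀ j‖ ^ 2 := by
  have hcont : ContinuousOn (fun t => ‖a k t l‖ ^ 2) (Icc 0 1) := by
    have h1 := ((h k).ac_re l 1 zero_le_one).continuousOn
    have h2 := ((h k).ac_im l 1 zero_le_one).continuousOn
    rw [uIcc_of_le zero_le_one] at h1 h2
    simp only [Complex.sq_norm, Complex.normSq_apply]
    exact (h1.mul h1).add (h2.mul h2)
  have h0 : ∀ᶠ t in 𝓝[Icc 0 1] (0 : ℝ), 0 < ‖a k t l‖ ^ 2 :=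
    (hcont 0 (by simp)).eventually (lt_mem_nhds (by positivity))
  obtain ⟨ε, hε, hεa⟩ := Metric.mem_nhdsWithin_iff.1 h0
  set r := min η (min ε 1) with hr
  have hr0 : 0 < r := by positivity
  have hae : ∀ᵐ t ∂(volume.restrict (Ioo 0 r)), t ∈ Ioo 0 r ∧ ∀ K : ℤ, 0 < t →
      Summable fun j : ℤ => (1 + (j : ℝ) ^ 2) * ‖a K t j‖ ^ 2 :=
    (ae_restrict_mem measurableSet_Ioo).and
      (ae_restrict_of_ae (ae_all_iff.2 fun K => (h K).summable_H1))
  have hne : NeBot (ae ((volume : Measure ℝ).restrict (Ioo 0 r))) := by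
    rw [ae_neBot]
    exact fun h' => by
      rw [Measure.restrict_eq_zero, Real.volume_Ioo, ENNReal.ofReal_eq_zero] at h'
      linarith
  obtain ⟨t₀, ⟨ht1, ht2⟩, ht3⟩ := hae.exists
  refine ⟨t₀, ht1, ht2.trans_le (min_le_left _ _), fun h' => ?_, fun K => ?_⟩
  · have h1 : t₀ < ε := ht2.trans_le ((min_le_right _ _).trans (min_le_left _ _))
    have h2 : t₀ < 1 := ht2.trans_le ((min_le_right _ _).trans (min_le_right _ _))
    have h3 : 0 < ‖a k t₀ l‖ ^ 2 := hεa
      ⟨by rwa [Metric.mem_ball, Real.dist_eq, sub_zero, abs_of_pos ht1], ht1.le, h2.le⟩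
    simp [h'] at h3
  · refine Summable.of_nonneg_of_le (fun j => by positivity) (fun j => ?_) (ht3 K ht1)
    have := sq_nonneg ‖a K t₀ j‖
    linarith

/-- For large times, a solution is dominated by finitely many of its modes in `x`, so that its
`H⁻¹` norm is comparable to its `L²` norm. -/
lemma eventually_tsum_le {M : ℝ} {a g : ℤ → ℝ → ℤ → ℂ} (h : ∀ k : ℤ, ShearMode k M (a k) (g k))
    (hsum : ∀ t ≥ 0, Summable fun n : ℤ × ℤ => ‖a n.1 t n.2‖ ^ 2)
    {k l : ℤ} (hkl : a k 0 l ≠ 0) :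
    ∃ B > 0, ∀ᶠ t in atTop, ∑' n : ℤ × ℤ, ‖a n.1 t n.2‖ ^ 2 ≤
      B * ∑' n : ℤ × ℤ, (1 + (n.1 : ℝ) ^ 2 + (n.2 : ℝ) ^ 2)⁻¹ * ‖a n.1 t n.2‖ ^ 2 := by
  obtain ⟨t₀, ht₀, -, hne, hH⟩ := exists_small_time h hkl one_pos
  have hpos : 0 < ∑' j, ‖a k t₀ j‖ ^ 2 :=
    ((h k).summable_sq t₀ ht₀.le).tsum_pos (fun _ => sq_nonneg _) l (by positivity)
  obtain ⟨c, hc, κ, hκ⟩ := (h k).exists_exp_le ht₀.le (hH k) hpos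
  choose B hB0 hB using fun K : ℤ => (h K).exists_le_mul ht₀.le (hH K)
  obtain ⟨K₀, hK₀⟩ := exists_nat_ge (max |(k : ℝ)| (max (κ + 1) 1))
  have hK1 : |(k : ℝ)| ≤ K₀ := (le_max_left _ _).trans hK₀
  have hK2 : κ + 1 ≤ K₀ := (le_max_left _ _).trans ((le_max_right _ _).trans hK₀)
  have hK3 : (1 : ℝ) ≤ K₀ := (le_max_right _ _).trans ((le_max_right _ _).trans hK₀)
  set s : Finset ℤ := Finset.Icc (-(K₀ : ℤ)) K₀ with hs
  have hks : k ∈ s := by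
    rw [hs, Finset.mem_Icc, ← abs_le]
    exact_mod_cast hK1
  have hBs : ∀ K ∈ s, B K ≤ ∑ K ∈ s, B K := fun K hK =>
    Finset.single_le_sum (fun K _ => (hB0 K).le) hK
  have hBpos : 0 < ∑ K ∈ s, B K := (hB0 k).trans_le (hBs k hks)
  refine ⟨2 * ∑ K ∈ s, B K, by positivity, ?_⟩
  set T₀ := ∑' n : ℤ × ℤ, ‖a n.1 0 n.2‖ ^ 2 with hT₀
  -- the modes outside `s` decay faster than the mode `k`
  have hdecay : ∀ᶠ t : ℝ in atTop,
      Real.exp (-(2 * (K₀ : ℝ) ^ 2 * t)) * T₀ ≤ c * Real.exp (-(κ * t)) := by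
    have hlim : Tendsto (fun t : ℝ => Real.exp (-((2 * (K₀ : ℝ) ^ 2 - κ) * t)) * T₀) atTop
        (𝓝 (0 * T₀)) := by
      refine Tendsto.mul_const _ (Real.tendsto_exp_neg_atTop_nhds_zero.comp ?_)
      exact tendsto_id.const_mul_atTop (by nlinarith)
    rw [zero_mul] at hlim
    filter_upwards [hlim.eventually (gt_mem_nhds hc)] with t ht
    have : Real.exp (-(2 * (K₀ : ℝ) ^ 2 * t)) =
        Real.exp (-((2 * (K₀ : ℝ) ^ 2 - κ) * t)) * Real.exp (-(κ * t)) := by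
      rw [← Real.exp_add]
      congr 1
      ring
    rw [this, mul_right_comm]
    exact mul_le_mul_of_nonneg_right ht.le (Real.exp_pos _).le
  filter_upwards [hdecay, eventually_ge_atTop t₀] with t ht htt
  have ht0 : 0 ≤ t := ht₀.le.trans htt
  set E : ℤ → ℝ := fun K => ∑' j, ‖a K t j‖ ^ 2 with hE
  set G : ℤ → ℝ := fun K => ∑' j : ℤ, (1 + (K : ℝ) ^ 2 + (j : ℝ) ^ 2)⁻¹ * ‖a K t j‖ ^ 2 with hG
  have hE0 : ∀ K, 0 ≤ E K := fun K => tsum_nonneg fun _ => sq_nonneg _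
  have hG0 : ∀ K, 0 ≤ G K := fun K => tsum_nonneg fun _ => by positivity
  have hst := hsum t ht0
  have hsE : Summable E := hst.prod
  have hsG' : Summable fun n : ℤ × ℤ =>
      (1 + (n.1 : ℝ) ^ 2 + (n.2 : ℝ) ^ 2)⁻¹ * ‖a n.1 t n.2‖ ^ 2 := by
    refine Summable.of_nonneg_of_le (fun n => by positivity) (fun n => ?_) hst
    refine mul_le_of_le_one_left (sq_nonneg _) (inv_le_one_of_one_le₀ ?_)
    nlinarith [sq_nonneg (n.1 : ℝ), sq_nonneg (n.2 : ℝ)]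
  have hsG : Summable G := hsG'.prod
  rw [show (∑' n : ℤ × ℤ, ‖a n.1 t n.2‖ ^ 2) = ∑' K, E K from hst.tsum_prod,
    show (∑' n : ℤ × ℤ, (1 + (n.1 : ℝ) ^ 2 + (n.2 : ℝ) ^ 2)⁻¹ * ‖a n.1 t n.2‖ ^ 2) =
      ∑' K, G K from hsG'.tsum_prod]
  have hhigh : ∑' K : {K : ℤ // K ∉ s}, E K ≤ Real.exp (-(2 * (K₀ : ℝ) ^ 2 * t)) * T₀ := by
    have hs0 := hsum 0 le_rfl
    have hE00 : Summable fun K : ℤ => ∑' j, ‖a K 0 j‖ ^ 2 := hs0.prod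
    have h1 : ∀ K : {K : ℤ // K ∉ s}, E K ≤
        Real.exp (-(2 * (K₀ : ℝ) ^ 2 * t)) * ∑' j, ‖a K 0 j‖ ^ 2 := by
      rintro ⟨K, hK⟩
      have h2 := (h K).energy_le ht0
      have h3 : (K₀ : ℝ) ^ 2 ≤ (K : ℝ) ^ 2 := by
        rw [hs, Finset.mem_Icc, ← abs_le, not_le] at hK
        rw [sq_le_sq, Nat.abs_cast]
        exact_mod_cast hK.le
      rw [Real.exp_neg, ← div_eq_inv_mul, le_div_iff₀ (Real.exp_pos _), mul_comm]
      refine le_trans (mul_le_mul_of_nonneg_right ?_ (hE0 K)) h2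
      gcongr
    calc _ ≤ ∑' K : {K : ℤ // K ∉ s},
          Real.exp (-(2 * (K₀ : ℝ) ^ 2 * t)) * ∑' j, ‖a K 0 j‖ ^ 2 :=
          (hsE.subtype _).tsum_le_tsum h1 ((hE00.subtype _).mul_left _)
      _ = Real.exp (-(2 * (K₀ : ℝ) ^ 2 * t)) *
          ∑' K : {K : ℤ // K ∉ s}, ∑' j, ‖a K 0 j‖ ^ 2 := tsum_mul_left
      _ ≤ _ := by
        refine mul_le_mul_of_nonneg_left ?_ (Real.exp_pos _).le
        rw [hT₀, show (∑' n : ℤ × ℤ, ‖a n.1 0 n.2‖ ^ 2) = ∑' K, ∑' j, ‖a K 0 j‖ ^ 2 from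
          hs0.tsum_prod, tsum_eq_sum_add_tail hE00 s]
        exact le_add_of_nonneg_left
          (Finset.sum_nonneg fun K _ => tsum_nonneg fun _ => sq_nonneg _)
  have hlow : c * Real.exp (-(κ * t)) ≤ ∑ K ∈ s, E K :=
    (hκ t htt).trans (Finset.single_le_sum (fun K _ => hE0 K) hks)
  calc ∑' K, E K = ∑ K ∈ s, E K + ∑' K : {K : ℤ // K ∉ s}, E K := tsum_eq_sum_add_tail hsE s
    _ ≤ 2 * ∑ K ∈ s, E K := by linarith
    _ ≤ 2 * ∑ K ∈ s, (∑ K ∈ s, B K) * G K := by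
        refine mul_le_mul_of_nonneg_left (Finset.sum_le_sum fun K hK => ?_) zero_le_two
        exact (hB K t htt).trans (mul_le_mul_of_nonneg_right (hBs K hK) (hG0 K))
    _ = 2 * (∑ K ∈ s, B K) * ∑ K ∈ s, G K := by rw [← Finset.mul_sum, mul_assoc]
    _ ≤ _ := mul_le_mul_of_nonneg_left (hsG.sum_le_tsum s fun K _ => hG0 K) (by positivity)

end TorusShear

theorem mainTheorem2 (U : ℝ → ℝ → ℝ) (hU : TorusShear.IsShearProfile U)
    (ρ : ℝ → ℝ × ℝ → ℝ) (hρ : TorusShear.IsSolution U ρ)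
    (hmean : ∫ p in TorusShear.torusCell, ρ 0 p = 0)
    (hne : TorusShear.normL2 (ρ 0) ≠ 0)
    (hsmooth : ∀ t > 0, ContDiff ℝ ∞ (ρ t)) :
    (∀ t ≥ 0, TorusShear.normL2 (ρ t) ≠ 0) ∧
      0 < limsup (fun t : ℝ => TorusShear.sobolevNorm (-1) (ρ t) / TorusShear.normL2 (ρ t))
        atTop := by
  open TorusShear in
  obtain ⟨M, hM⟩ := hρ.exists_shearMode hU
  have hsum : ∀ t ≥ 0, Summable fun n : ℤ × ℤ => ‖torusFourierCoeff (ρ t) (n.1, n.2)‖ ^ 2 :=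
    fun t ht => hρ.summable_sq ht
  obtain ⟨⟨k, l⟩, hkl⟩ : ∃ n, torusFourierCoeff (ρ 0) n ≠ 0 := by
    by_contra! h0
    have h1 := normL2_sq (hρ.memL2 0 le_rfl) (hρ.summable_sq le_rfl)
    simp only [h0, norm_zero, ne_eq, OfNat.ofNat_ne_zero, not_false_eq_true, zero_pow, tsum_zero,
      mul_zero, ENNReal.ofReal_zero, pow_eq_zero_iff] at h1
    exact hne h1
  have hpos : ∀ t ≥ 0, normL2 (ρ t) ≠ 0 := by
    intro t ht h0
    rcases ht.lt_or_eq with ht' | rfl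
    · obtain ⟨t₀, ht₀, htt, hne₀, hH⟩ := exists_small_time
        (a := fun k t l => torusFourierCoeff (ρ t) (k, l)) hM hkl ht'
      have hE : 0 < ∑' j : ℤ, ‖torusFourierCoeff (ρ t₀) (k, j)‖ ^ 2 :=
        ((hM k).summable_sq t₀ ht₀.le).tsum_pos (fun _ => sq_nonneg _) l (by positivity)
      obtain ⟨c, hc, κ, hκ⟩ := (hM k).exists_exp_le ht₀.le (hH k) hE
      have h1 := normL2_sq (hρ.memL2 t ht) (hρ.summable_sq ht)
      rw [h0, zero_pow two_ne_zero, eq_comm, ENNReal.ofReal_eq_zero] at h1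
      have h2 : ∑' n, ‖torusFourierCoeff (ρ t) n‖ ^ 2 ≤ 0 :=
        nonpos_of_mul_nonpos_right h1 (by positivity)
      have h3 : ∑' j : ℤ, ‖torusFourierCoeff (ρ t) (k, j)‖ ^ 2 ≤
          ∑' n, ‖torusFourierCoeff (ρ t) n‖ ^ 2 :=
        ((hM k).summable_sq t ht).tsum_le_tsum_of_inj (fun j => (k, j))
          (fun a b h => (Prod.mk.inj h).2) (fun _ _ => sq_nonneg _) (fun _ => le_rfl)
          (hρ.summable_sq ht)
      have h4 := hκ t htt.le
      have h5 : 0 < c * Real.exp (-(κ * t)) := by positivity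
      linarith
    · exact hne h0
  refine ⟨hpos, ?_⟩
  obtain ⟨B, hB, hev⟩ := eventually_tsum_le
    (a := fun k t l => torusFourierCoeff (ρ t) (k, l)) hM hsum hkl
  have hC0 : ENNReal.ofReal √B ≠ 0 := by simpa using hB
  have key : ∀ᶠ t : ℝ in atTop,
      (ENNReal.ofReal √B)⁻¹ ≤ sobolevNorm (-1) (ρ t) / normL2 (ρ t) := by
    filter_upwards [hev, eventually_ge_atTop 0] with t ht ht0
    have h1 : normL2 (ρ t) ^ 2 ≤ (ENNReal.ofReal √B * sobolevNorm (-1) (ρ t)) ^ 2 := by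
      rw [mul_pow, sobolevNorm_neg_one_sq (hρ.summable_sq ht0),
        normL2_sq (hρ.memL2 t ht0) (hρ.summable_sq ht0), ← ENNReal.ofReal_pow (Real.sqrt_nonneg _),
        Real.sq_sqrt hB.le, ← ENNReal.ofReal_mul hB.le, mul_left_comm]
      exact ENNReal.ofReal_le_ofReal (mul_le_mul_of_nonneg_left ht (by positivity))
    have h2 : normL2 (ρ t) ≤ ENNReal.ofReal √B * sobolevNorm (-1) (ρ t) :=
      (ENNReal.pow_le_pow_left_iff two_ne_zero).1 h1
    rw [ENNReal.le_div_iff_mul_le (Or.inl (hpos t ht0)) (Or.inl (hρ.memL2 t ht0).2.ne),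
      mul_comm, ← div_eq_mul_inv]
    exact ENNReal.div_le_of_le_mul' h2
  refine lt_of_lt_of_le ?_ (le_limsup_of_frequently_le key.frequently)
  exact ENNReal.inv_pos.2 ENNReal.ofReal_ne_top
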